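/- **Conventions.** A groupoid $G$ is identified with its set of arrows, with source $\mathsf s(g)=g^{-1}g$, range $\mathsf r(g)=gg^{-1}$, units $G^0=\{g:gg=g\}$; $gh$ is defined iff $\mathsf s(g)=\mathsf r(h)$. A *slice* is a subset $B\subseteq G$ on which $\mathsf s$ and $\mathsf r$ are injective; for $A,B\subseteq G$, $AB=\{gh: g\in A,\ h\in B,\ gh \text{ defined}\}$. A topological groupoid has continuous inverse and product; it is *étale* if $\mathsf s:G\to G$ is open. No Hausdorff assumption is made. A *groupoid bundle* is an open continuous functor $\pi:F\to G$, injective on units, from a topological groupoid $F$ to an étale groupoid $G$. A *slice-section* of $\pi$ is a continuous function $a$ from an open slice $\mathrm{dom}(a)$ of $G$ to $F$ with $\pi(a(g))=g$ for all $g\in\mathrm{dom}(a)$. The set $\mathcal S(\pi)$ of slice-sections has the product with $\mathrm{dom}(ab)=\mathrm{dom}(a)\,\mathrm{dom}(b)$ and $(ab)(gh)=a(g)b(h)$. A relation $\phi\subseteq G\times G'$ between étale groupoids (written $g\,\phi\,g'$) is a *Zakrzewski morphism* if $\phi^{-1}[O]=\{g':\exists g\in O\,(g\,\phi\,g')\}$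 is open for every open $O\subseteq G$; $g\,\phi\,g'$ implies $g^{-1}\,\phi\,g'^{-1}$; whenever $g\,\phi\,g'$, $h\,\phi\,h'$ and $g'h'$ is defined, $gh$ is defined and $gh\,\phi\,g'h'$; and whenever $\mathsf r(g)\,\phi\,h\in G'^0$ there is exactly one $i\in G'$ with $\mathsf r(i)=h$ and $g\,\phi\,i$. A *Pierce morphism* from a groupoid bundle $\pi:F\to G$ to a groupoid bundle $\pi':F'\to G'$ is a pair $(\phi,\tau)$ of a Zakrzewski morphism $\phi\subseteq G\times G'$ which is a function on its domain ($g\,\phi\,g'$ and $h\,\phi\,g'$ imply $g=h$; write $g=\phi(g')$), and a continuous functor $\tau:\phi^\pi F=\{(f,g')\in F\times G':\pi(f)\,\phi\,g'\}\to F'$ with $\pi'(\tau(f,g'))=g'$, where $\phi^\pi F$ carries the subspace topology and the product $(f,g')(e,h')=(fe,g'h')$ when $g'h'$ is defined. For $a\in\mathcal S(\pi)$, $\frac{\tau}{\phi}(a)\in\mathcal S(\pi')$ is defined on $\phi^{-1}[\mathrm{dom}(a)]$ by $\frac{\tau}{\phi}(a)(g')=\tau(a(\phi(g')),g')$. A *structured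 semigroup* $(S,N,Z)$ is a semigroup $S$ with subsemigroups $Z\subseteq N$ such that every element of $Z$ commutes with every element of $N$; $ab,ba\in Z$ implies $aZb\cup bZa\subseteq Z$; and, for $n\in N$, $abn=n=nab$ and $ab,ba\in Z$ imply $bna\in N$. Write $a<_s b$ if $asb=a=bsa$, $as,sa\in N$ and $bs,sb\in Z$, and $a<b$ if $a<_s b$ for some $s\in S$. For $A\subseteq S$ put $A^<=\{b:\exists a\in A\,(a<b)\}$ and $A^*=\{s:\exists a\in A\,\exists b\in S\,(a<_s b)\}$. A *coset* is a $C\subseteq S$ with $CC^*C\subseteq C=C^<$. The set $\mathcal C(S)$ of non-empty cosets is a groupoid with inverse $C\mapsto C^*$ and product $B\cdot C=(BC)^<$, defined when $(B^*B)^<=(CC^*)^<$; its topology is generated by the sets $\mathcal C_a=\{C\in\mathcal C(S):a\in C\}$, $a\in S$. For $a,b\in C\in\mathcal C(S)$ let $a\sim_C b$ if $sat=sbt$ for some $s,t\in C^*$, and let $[a,C]$ be the pair of the $\sim_C$-class of $a$ in $C$ and $C$. Then $\tilde{\mathcal C}(S)=\{[c,C]:c\in C\in\mathcal C(S)\}$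 is a groupoid with product $[a,A][b,B]=[ab,A\cdot B]$ (when $A\cdot B$ is defined) and inverse $[c,C]^{-1}=[c',C^*]$ for any $c'$ with $d<_{c'}c$ for some $d\in C$; its topology is generated by the sets $\{[s,C]:s\in C\in\mathcal C(S)\}$ and $\{[c,C]:c,s\in C\in\mathcal C(S)\}$, $s\in S$. The *coset bundle* is $\rho_{\mathcal C}:\tilde{\mathcal C}(S)\to\mathcal C(S)$, $[c,C]\mapsto C$. A *bundle representation* of $(S,N,Z)$ on a groupoid bundle $\pi:F\to G$ is a semigroup homomorphism $\theta:S\to\mathcal S(\pi)$ such that the sets $\mathrm{dom}(\theta(a))$, $a\in S$, cover $G$; $\mathrm{dom}(\theta(n))\subseteq G^0$ for all $n\in N$; and whenever $g\in\mathrm{dom}(\theta(a))$ there is $b<a$ with $g\in\mathrm{dom}(\theta(b))$. **Theorem.** Let $(S,N,Z)$ be a structured semigroup such that $Z$ is symmetric, i.e. $ab\in Z$ implies $baba\in Z$ for all $a,b\in S$. Then $\rho_{\mathcal C}$ is a groupoid bundle and $a\mapsto\tilde a$ is a bundle representation of $(S,N,Z)$ on it, where $\mathrm{dom}(\tilde a)=\mathcal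 C_a$ and $\tilde a(C)=[a,C]$ for $C\in\mathcal C_a$. It is universal: for every bundle representation $\theta$ of $(S,N,Z)$ on a groupoid bundle $\pi'$, there is a unique Pierce morphism $(\phi,\tau)$ from $\rho_{\mathcal C}$ to $\pi'$ such that $\theta(a)=\frac{\tau}{\phi}(\tilde a)$ for all $a\in S$. -/

import Mathlib

universe u v w x y

open scoped Pointwise

/-! ## Groupoids, as sets of arrows with a partially defined product -/

/-- A groupoid, viewed as its set of arrows. The product `gh` is defined iff the source
`g⁻¹g` of `g` is the range `hh⁻¹` of `h`; the value of `mul g h` at other pairs carries no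
meaning and is never used. -/
class ArrowGroupoid (G : Type*) where
  inv : G → G
  mul : G → G → G
  inv_inv : ∀ g, inv (inv g) = g
  assoc : ∀ g h k, mul (inv g) g = mul h (inv h) → mul (inv h) h = mul k (inv k) →
    mul (inv (mul g h)) (mul g h) = mul k (inv k) ∧
    mul (inv g) g = mul (mul h k) (inv (mul h k)) ∧
    mul (mul g h) k = mul g (mul h k)
  inv_mul_mul : ∀ g h, mul (inv g) g = mul h (inv h) → mul (inv g) (mul g h) = h
  mul_mul_inv : ∀ g h, mul (inv g) g = mul h (inv h) → mul (mul g h) (inv h) = g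

namespace ArrowGroupoid

variable {G : Type*} [ArrowGroupoid G]

/-- The source `s(g) = g⁻¹g`. -/
def src (g : G) : G := mul (inv g) g

/-- The range `r(g) = gg⁻¹`. -/
def rng (g : G) : G := mul g (inv g)

/-- `gh` is defined. -/
def Comp (g h : G) : Prop := src g = rng h

/-- `G⁰ = {g : gg = g}`. -/
def units (G : Type*) [ArrowGroupoid G] : Set G := {g | Comp g g ∧ mul g g = g}

/-- The product `AB` of two sets of arrows. -/
def setMul (A B : Set G) : Set G := {k | ∃ g ∈ A, ∃ h ∈ B, Comp g h ∧ k = mul g h}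

/-- Slices (bisections): source and range are injective on `B`. -/
def IsSlice (B : Set G) : Prop := Set.InjOn (src : G → G) B ∧ Set.InjOn (rng : G → G) B

end ArrowGroupoid

open ArrowGroupoid

/-- Topological groupoids. -/
structure IsTopGroupoid (G : Type*) [ArrowGroupoid G] [TopologicalSpace G] : Prop where
  continuous_inv : Continuous (inv : G → G)
  continuous_mul : Continuous (fun p : {p : G × G // Comp p.1 p.2} => mul p.1.1 p.1.2)

/-- Étale groupoids: topological groupoids whose source map `s : G → G` is open. -/
structure IsEtaleGroupoid (G : Type*) [ArrowGroupoid G] [TopologicalSpace G] : Prop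
    extends IsTopGroupoid G where
  isOpenMap_src : IsOpenMap (src : G → G)

/-- Functors between groupoids that are injective on units. -/
structure IsIsocofibration {F G : Type*} [ArrowGroupoid F] [ArrowGroupoid G] (π : F → G) :
    Prop where
  map_mul : ∀ e f, Comp e f → Comp (π e) (π f) ∧ π (mul e f) = mul (π e) (π f)
  injOn_units : Set.InjOn π (units F)

/-- Groupoid bundles `π : F → G`. -/
structure IsGroupoidBundle {F G : Type*} [ArrowGroupoid F] [TopologicalSpace F]
    [ArrowGroupoid G] [TopologicalSpace G] (π : F → G) : Prop where
  top : IsTopGroupoid F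
  etale : IsEtaleGroupoid G
  isocofibration : IsIsocofibration π
  continuous : Continuous π
  isOpenMap : IsOpenMap π

/-! ## Relations

A subset `φ` of `G × H` is a relation from `H` to `G`; a (partial) function from `H` to `G` is
the relation `{(φ(h), h) : h ∈ dom φ}`. -/

namespace BinRel

variable {G H : Type*}

/-- The preimage `φ⁻¹[A]` of `A ⊆ G`. -/
def preim (φ : Set (G × H)) (A : Set G) : Set H := {h | ∃ g ∈ A, (g, h) ∈ φ}

/-- The domain of `φ`. -/
def dom (φ : Set (G × H)) : Set H := preim φ Set.univ

/-- `φ` is a function on its domain. -/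
def IsFunction (φ : Set (G × H)) : Prop := ∀ g g' h, (g, h) ∈ φ → (g', h) ∈ φ → g = g'

/-- `φ⁻¹[O]` is open for all open `O`. For a function this says that the domain is open and
that the function is continuous on it. -/
def IsContinuous [TopologicalSpace G] [TopologicalSpace H] (φ : Set (G × H)) : Prop :=
  ∀ O : Set G, IsOpen O → IsOpen (preim φ O)

end BinRel

/-! ## Slice-sections -/

/-- `a` is a slice-section of `π : F → G`: a continuous function from an open slice of `G` to
`F` such that `π ∘ a` is the identity. -/
structure IsSliceSection {F G : Type*} [TopologicalSpace F] [ArrowGroupoid G]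
    [TopologicalSpace G] (π : F → G) (a : Set (F × G)) : Prop where
  isFunction : BinRel.IsFunction a
  isContinuous : BinRel.IsContinuous a
  isOpen_dom : IsOpen (BinRel.dom a)
  isSlice_dom : IsSlice (BinRel.dom a)
  proj : ∀ f g, (f, g) ∈ a → π f = g

/-- The product of slice-sections: `(ab)(gh) = a(g)b(h)` for `g ∈ dom a` and `h ∈ dom b` such
that `gh` is defined. -/
def sectionMul {F G : Type*} [ArrowGroupoid F] [ArrowGroupoid G] (a b : Set (F × G)) :
    Set (F × G) :=
  {p | ∃ e g f h, (e, g) ∈ a ∧ (f, h) ∈ b ∧ Comp g h ∧ p = (mul e f, mul g h)}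

/-! ## Morphisms -/

/-- Functorial relations between groupoids. -/
structure IsFunctorial {G H : Type*} [ArrowGroupoid G] [ArrowGroupoid H] (φ : Set (G × H)) :
    Prop where
  inv_mem : ∀ g h, (g, h) ∈ φ → (inv g, inv h) ∈ φ
  mul_mem : ∀ g h g' h', (g, h) ∈ φ → (g', h') ∈ φ → Comp h h' →
    Comp g g' ∧ (mul g g', mul h h') ∈ φ

/-- Zakrzewski morphisms: continuous star-bijective functorial relations. -/
structure IsZakrzewski {G H : Type*} [ArrowGroupoid G] [TopologicalSpace G]
    [ArrowGroupoid H] [TopologicalSpace H] (φ : Set (G × H)) : Prop where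
  functorial : IsFunctorial φ
  star_bijective : ∀ g h, h ∈ units H → (rng g, h) ∈ φ → ∃! i, rng i = h ∧ (g, i) ∈ φ
  continuous : BinRel.IsContinuous φ

/-- The pullback `{(f, h) ∈ F × H : π(f) φ h}`, with the subspace topology. Its product is
`(f, h)(f', h') = (ff', hh')` when `hh'` is defined. -/
abbrev Pullback {F G H : Type*} (π : F → G) (φ : Set (G × H)) : Type _ :=
  {p : F × H // (π p.1, p.2) ∈ φ}

/-- `(φ, τ)` is a Pierce morphism from `π : F → G` to `π' : F' → G'`. -/
structure IsPierce {F G F' G' : Type*} [ArrowGroupoid F] [TopologicalSpace F]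
    [ArrowGroupoid G] [TopologicalSpace G] [ArrowGroupoid F'] [TopologicalSpace F']
    [ArrowGroupoid G'] [TopologicalSpace G'] (π : F → G) (π' : F' → G')
    (φ : Set (G × G')) (τ : Pullback π φ → F') : Prop where
  zakrzewski : IsZakrzewski φ
  isFunction : BinRel.IsFunction φ
  continuous : Continuous τ
  map_mul : ∀ p q t : Pullback π φ, Comp p.1.2 q.1.2 →
    t.1 = (mul p.1.1 q.1.1, mul p.1.2 q.1.2) →
    Comp (τ p) (τ q) ∧ τ t = mul (τ p) (τ q)
  proj : ∀ p : Pullback π φ, π' (τ p) = p.1.2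

/-- The action `τ/φ` on slice-sections:
`(τ/φ)(a)(g') = τ(a(φ(g')), g')` for all `g' ∈ φ⁻¹[dom a]`. -/
def fracAct {F G F' G' : Type*} {π : F → G} (φ : Set (G × G')) (τ : Pullback π φ → F')
    (a : Set (F × G)) : Set (F' × G') :=
  {q | ∃ p : Pullback π φ, (p.1.1, π p.1.1) ∈ a ∧ q = (τ p, p.1.2)}

/-! ## Structured semigroups -/

/-- A structured semigroup `(S, N, Z)`: `N` is a `Z`-trinormal subsemigroup of `S` and
`Z ⊆ Z(N)` is a binormal subsemigroup of `S`. -/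
structure StructuredSemigroup (S : Type*) [Semigroup S] where
  N : Subsemigroup S
  Z : Subsemigroup S
  trinormal : ∀ a b n, n ∈ N → a * b * n = n → n = n * a * b → a * b ∈ Z → b * a ∈ Z →
    b * n * a ∈ N
  Z_le_N : Z ≤ N
  comm : ∀ z ∈ Z, ∀ n ∈ N, z * n = n * z
  binormal : ∀ a b, a * b ∈ Z → b * a ∈ Z → ∀ z ∈ Z, a * z * b ∈ Z ∧ b * z * a ∈ Z

namespace StructuredSemigroup

variable {S : Type u} [Semigroup S] (T : StructuredSemigroup S)

/-- `Z` is symmetric: `ab ∈ Z` implies `baba ∈ Z`. -/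
def IsSymmetric : Prop := ∀ a b, a * b ∈ T.Z → b * a * b * a ∈ T.Z

/-- `a <ₛ b`: `b` dominates `a` via `s`. -/
structure DomVia (a s b : S) : Prop where
  left : a * s * b = a
  right : b * s * a = a
  as_mem : a * s ∈ T.N
  sa_mem : s * a ∈ T.N
  bs_mem : b * s ∈ T.Z
  sb_mem : s * b ∈ T.Z

/-- The domination relation `a < b`. -/
def Dom (a b : S) : Prop := ∃ s, T.DomVia a s b

/-- The up-closure `A^<`. -/
def up (A : Set S) : Set S := {b | ∃ a ∈ A, T.Dom a b}

/-- The dual `A^*`. -/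
def star (A : Set S) : Set S := {s | ∃ a ∈ A, ∃ b, T.DomVia a s b}

/-- Atlases. -/
structure IsAtlas (A : Set S) : Prop where
  triple : A * T.star A * A ⊆ A
  round : A ⊆ T.up A

/-- Cosets. -/
structure IsCoset (C : Set S) : Prop where
  triple : C * T.star C * C ⊆ C
  eq_up : C = T.up C

variable {T}

theorem zn {z n : S} (hz : z ∈ T.Z) (hn : n ∈ T.N) : z * n = n * z := T.comm z hz n hn

theorem zz {z n : S} (hz : z ∈ T.Z) (hn : n ∈ T.Z) : z * n = n * z :=
  T.comm z hz n (T.Z_le_N hn)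

theorem domVia_of_left {a s b : S} (h : a * s * b = a) (h1 : a * s ∈ T.N) (h2 : b * s ∈ T.Z)
    (h3 : s * b ∈ T.Z) : T.DomVia a s b := by
  have e : b * s * a = a := by
    calc b * s * a = b * s * (a * s * b) := by rw [h]
      _ = (b * s) * (a * s) * b := by simp only [mul_assoc]
      _ = (a * s) * (b * s) * b := by rw [zn h2 h1]
      _ = (a * s * b) * s * b := by simp only [mul_assoc]
      _ = a := by rw [h, h]
  refine ⟨h, e, h1, ?_, h2, h3⟩
  have := T.trinormal b s (a * s) h1 (by rw [← mul_assoc, e])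
    (by rw [h]) h2 h3
  rwa [mul_assoc, h] at this

theorem domVia_of_right {a s b : S} (h : b * s * a = a) (h1 : s * a ∈ T.N) (h2 : b * s ∈ T.Z)
    (h3 : s * b ∈ T.Z) : T.DomVia a s b := by
  have e : a * s * b = a := by
    calc a * s * b = b * s * a * s * b := by rw [h]
      _ = b * ((s * a) * (s * b)) := by simp only [mul_assoc]
      _ = b * ((s * b) * (s * a)) := by rw [zn h3 h1]
      _ = b * s * (b * s * a) := by simp only [mul_assoc]
      _ = a := by rw [h, h]
  refine ⟨e, h, ?_, h1, h2, h3⟩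
  have := T.trinormal s b (s * a) h1 (by simp only [mul_assoc] at h ⊢; rw [h])
    (by simp only [mul_assoc] at e ⊢; rw [e]) h3 h2
  rwa [← mul_assoc, h] at this

theorem DomVia.trans {a b' b c' c : S} (h : T.DomVia a b' b) (k : T.DomVia b c' c) :
    T.DomVia a c' c := by
  have e : a * c' = (a * b') * (b * c') := by
    rw [← mul_assoc, h.left]
  refine domVia_of_left ?_ ?_ k.bs_mem k.sb_mem
  · rw [e, ← mul_assoc, h.left]
    calc a * c' * c = a * b' * b * c' * c := by rw [h.left]
      _ = a * b' * (b * c' * c) := by simp only [mul_assoc]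
      _ = a := by rw [k.left, h.left]
  · rw [e]; exact mul_mem h.as_mem k.as_mem

theorem Dom.trans {a b c : S} (h : T.Dom a b) (k : T.Dom b c) : T.Dom a c := by
  obtain ⟨s, h⟩ := h
  obtain ⟨t, k⟩ := k
  exact ⟨t, h.trans k⟩

theorem switch_left {a b c' c : S} (h : a * b ∈ T.N) (k : T.DomVia b c' c) :
    T.DomVia (a * b * c') c c' := by
  have e : a * b * c' * c = a * b := by
    rw [mul_assoc (a * b), mul_assoc a, ← mul_assoc b, k.left]
  exact domVia_of_left (by rw [e]) (by rw [e]; exact h) k.sb_mem k.bs_mem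

theorem switch_right {a b c' c : S} (h : b * a ∈ T.N) (k : T.DomVia b c' c) :
    T.DomVia (c' * b * a) c c' := by
  have e : c * (c' * b * a) = b * a := by
    rw [← mul_assoc, ← mul_assoc, k.right]
  exact domVia_of_right (by rw [mul_assoc, e, mul_assoc]) (by rw [e]; exact h) k.sb_mem k.bs_mem

theorem DomVia.mul {a b' b c d' d : S} (h : T.DomVia a b' b) (k : T.DomVia c d' d) :
    T.DomVia (a * c) (d' * b') (b * d) := by
  have n1 : (b' * a) * (c * d') ∈ T.N := mul_mem h.sa_mem k.as_mem
  refine domVia_of_left ?_ ?_ ?_ ?_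
  · calc a * c * (d' * b') * (b * d) = a * ((c * d') * (b' * b)) * d := by simp only [mul_assoc]
      _ = a * ((b' * b) * (c * d')) * d := by rw [zn h.sb_mem k.as_mem]
      _ = (a * b' * b) * (c * d' * d) := by simp only [mul_assoc]
      _ = a * c := by rw [h.left, k.left]
  · have := T.trinormal b' b ((b' * a) * (c * d')) n1
      (by
        calc b' * b * (b' * a * (c * d')) = b' * (b * b' * a) * (c * d') := by
              simp only [mul_assoc]
          _ = _ := by rw [h.right])
      (by
        calc b' * a * (c * d') = b' * (b * b' * a) * (c * d') := by rw [h.right]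
          _ = (b' * b) * ((b' * a) * (c * d')) := by simp only [mul_assoc]
          _ = ((b' * a) * (c * d')) * (b' * b) := zn h.sb_mem n1
          _ = _ := by simp only [mul_assoc])
      h.sb_mem h.bs_mem
    have e : b * (b' * a * (c * d')) * b' = a * c * (d' * b') := by
      calc b * (b' * a * (c * d')) * b' = (b * b' * a) * (c * (d' * b')) := by
            simp only [mul_assoc]
        _ = _ := by rw [h.right, mul_assoc]
    rwa [e] at this
  · have := (T.binormal b b' h.bs_mem h.sb_mem _ k.bs_mem).1
    simpa only [mul_assoc] using this
  · have := (T.binormal d d' k.bs_mem k.sb_mem _ h.sb_mem).2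
    simpa only [mul_assoc] using this

theorem Dom.mul {a b c d : S} (h : T.Dom a b) (k : T.Dom c d) : T.Dom (a * c) (b * d) := by
  obtain ⟨s, h⟩ := h
  obtain ⟨t, k⟩ := k
  exact ⟨_, h.mul k⟩

theorem DomVia.n_mul {a b' b n : S} (h : T.DomVia a b' b) (hn : n ∈ T.N) :
    T.DomVia (n * a) b' b := by
  refine domVia_of_left ?_ ?_ h.bs_mem h.sb_mem
  · rw [mul_assoc, mul_assoc, ← mul_assoc a, h.left]
  · rw [mul_assoc]; exact mul_mem hn h.as_mem

theorem DomVia.mul_n {a b' b n : S} (h : T.DomVia a b' b) (hn : n ∈ T.N) :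
    T.DomVia (a * n) b' b := by
  refine domVia_of_right ?_ ?_ h.bs_mem h.sb_mem
  · rw [← mul_assoc, h.right]
  · rw [← mul_assoc]; exact mul_mem h.sa_mem hn

theorem Dom.n_mul {a b n : S} (h : T.Dom a b) (hn : n ∈ T.N) : T.Dom (n * a) b := by
  obtain ⟨s, h⟩ := h
  exact ⟨s, h.n_mul hn⟩

theorem Dom.mul_n {a b n : S} (h : T.Dom a b) (hn : n ∈ T.N) : T.Dom (a * n) b := by
  obtain ⟨s, h⟩ := h
  exact ⟨s, h.mul_n hn⟩

theorem DomVia.z_inv {a b' b z : S} (h : T.DomVia a b' b) (hz : z ∈ T.Z) (e : a * z = a) :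
    T.DomVia a (z * b') b := by
  refine domVia_of_left ?_ ?_ ?_ ?_
  · rw [← mul_assoc, e, h.left]
  · rw [← mul_assoc, e]; exact h.as_mem
  · rw [← mul_assoc]; exact (T.binormal b b' h.bs_mem h.sb_mem z hz).1
  · rw [mul_assoc]; exact mul_mem hz h.sb_mem

theorem DomVia.split {x b' b e e' : S} (h : T.DomVia x b' b) (h1 : e * e' ∈ T.Z)
    (h2 : e' * e ∈ T.Z) (hx : e' * e * x = x) : T.DomVia (e * x) (b' * e') (e * b) := by
  have k : (b' * e') * (e * x) = b' * x := by
    rw [← mul_assoc, mul_assoc b', mul_assoc, hx]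
  refine domVia_of_right ?_ ?_ ?_ ?_
  · rw [mul_assoc, k, mul_assoc, ← mul_assoc b, h.right]
  · rw [k]; exact h.sa_mem
  · have := (T.binormal e e' h1 h2 _ h.bs_mem).1
    simpa only [mul_assoc] using this
  · have := (T.binormal b b' h.bs_mem h.sb_mem _ h2).2
    simpa only [mul_assoc] using this

theorem up_up (A : Set S) : T.up (T.up A) ⊆ T.up A := by
  rintro c ⟨b, ⟨a, ha, h⟩, k⟩
  exact ⟨a, ha, h.trans k⟩

theorem up_mono {A B : Set S} (h : A ⊆ B) : T.up A ⊆ T.up B := by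
  rintro c ⟨a, ha, k⟩
  exact ⟨a, h ha, k⟩

theorem star_mono {A B : Set S} (h : A ⊆ B) : T.star A ⊆ T.star B := by
  rintro c ⟨a, ha, k⟩
  exact ⟨a, h ha, k⟩

theorem up_mul_up (A B : Set S) : T.up A * T.up B ⊆ T.up (A * B) := by
  rintro _ ⟨x, ⟨a, ha, h⟩, y, ⟨b, hb, k⟩, rfl⟩
  exact ⟨a * b, Set.mul_mem_mul ha hb, h.mul k⟩

theorem star_mul_star (A B : Set S) : T.star A * T.star B ⊆ T.star (B * A) := by
  rintro _ ⟨x, ⟨a, ha, a', h⟩, y, ⟨b, hb, b', k⟩, rfl⟩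
  exact ⟨b * a, Set.mul_mem_mul hb ha, _, k.mul h⟩

theorem star_up_subset (A : Set S) : T.star (T.up A) ⊆ T.up (T.star A) := by
  rintro c' ⟨b, ⟨a, ha, b', h⟩, c, k⟩
  refine ⟨b' * b * c', ⟨a, ha, c, (h.trans k).z_inv h.sb_mem ?_⟩, c, ?_⟩
  · rw [← mul_assoc, h.left]
  · exact switch_left (T.Z_le_N h.sb_mem) k

theorem up_up_subset (A : Set S) : T.up (T.up A) ⊆ T.star (T.star A) := by
  rintro c ⟨b, ⟨a, ha, b', h⟩, c', k⟩
  refine ⟨b' * b * c', ⟨a, ha, c, (h.trans k).z_inv h.sb_mem ?_⟩, c', ?_⟩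
  · rw [← mul_assoc, h.left]
  · exact switch_left (T.Z_le_N h.sb_mem) k

theorem star_triple {A : Set S} (hA : A * T.star A * A ⊆ A) :
    T.star A * T.star (T.star A) * T.star A ⊆ T.star A := by
  refine (Set.mul_subset_mul_right (star_mul_star _ _)).trans ((star_mul_star _ _).trans ?_)
  rw [← mul_assoc]
  exact star_mono hA

/-- The common core of the comparison of `A^{*<}` with `A^*` and of `A^{**}` with `A^<`. -/
theorem core {A : Set S} (hA : A * T.star A * A ⊆ A) {c b' b a a' : S} (hc : c ∈ A)
    (h : T.DomVia c b' b) (k : T.DomVia b' a a') : ∃ d ∈ A, T.DomVia d a' a := by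
  have hb' : b' ∈ T.star A := ⟨c, hc, b, h⟩
  have ha : a ∈ T.star (T.star A) := ⟨b', hb', a', k⟩
  refine ⟨c * (b' * a * b') * c, ?_, ?_⟩
  · apply hA
    refine Set.mul_mem_mul (Set.mul_mem_mul hc ?_) hc
    exact star_triple hA (Set.mul_mem_mul (Set.mul_mem_mul hb' ha) hb')
  · have e1 : (b * a') * (a * b') = b * b' := by
      calc (b * a') * (a * b') = b * (a' * a * b') := by simp only [mul_assoc]
        _ = _ := by rw [k.right]
    have z1 : (a * b') * (b * a') ∈ T.Z := by
      have := (T.binormal a a' k.sb_mem k.bs_mem _ h.sb_mem).1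
      simpa only [mul_assoc] using this
    have d1 := h.split (e := a * b') (e' := b * a') z1 (by rw [e1]; exact h.bs_mem)
      (by rw [e1, h.right])
    have d2 : T.DomVia (a * b' * b) a' a := switch_right (T.Z_le_N h.sb_mem) k
    have d3 := (d1.n_mul h.as_mem).trans d2
    have e2 : c * (b' * a * b') * c = c * b' * (a * b' * c) := by simp only [mul_assoc]
    rw [e2]; exact d3

theorem up_star_subset {A : Set S} (hA : A * T.star A * A ⊆ A) :
    T.up (T.star A) ⊆ T.star A := by
  rintro a' ⟨b', ⟨c, hc, b, h⟩, a, k⟩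
  obtain ⟨d, hd, e⟩ := core hA hc h k
  exact ⟨d, hd, a, e⟩

theorem star_star_subset {A : Set S} (hA : A * T.star A * A ⊆ A) :
    T.star (T.star A) ⊆ T.up A := by
  rintro a ⟨b', ⟨c, hc, b, h⟩, a', k⟩
  obtain ⟨d, hd, e⟩ := core hA hc h k
  exact ⟨d, hd, a', e⟩

theorem IsAtlas.star_up {A : Set S} (h : T.IsAtlas A) : T.star (T.up A) = T.star A :=
  Set.Subset.antisymm ((star_up_subset A).trans (up_star_subset h.triple)) (star_mono h.round)

theorem IsAtlas.star {A : Set S} (h : T.IsAtlas A) : T.IsCoset (T.star A) :=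
  ⟨star_triple h.triple, Set.Subset.antisymm
    ((star_mono h.round).trans (star_up_subset A)) (up_star_subset h.triple)⟩

theorem IsAtlas.star_star {A : Set S} (h : T.IsAtlas A) : T.star (T.star A) = T.up A :=
  Set.Subset.antisymm (star_star_subset h.triple)
    ((up_mono h.round).trans (up_up_subset A))

theorem IsCoset.atlas {C : Set S} (h : T.IsCoset C) : T.IsAtlas C := ⟨h.triple, h.eq_up.subset⟩

theorem IsAtlas.up {A : Set S} (h : T.IsAtlas A) : T.IsCoset (T.up A) := by
  rw [← h.star_star]; exact h.star.atlas.star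

theorem IsCoset.star_star {C : Set S} (h : T.IsCoset C) : T.star (T.star C) = C := by
  rw [h.atlas.star_star, ← h.eq_up]

theorem IsCoset.up_mem {C : Set S} (h : T.IsCoset C) {a b : S} (ha : a ∈ C) (hab : T.Dom a b) :
    b ∈ C := by
  rw [h.eq_up]; exact ⟨a, ha, hab⟩

theorem IsCoset.mul3 {C : Set S} (h : T.IsCoset C) {a s b : S} (ha : a ∈ C)
    (hs : s ∈ T.star C) (hb : b ∈ C) : a * s * b ∈ C :=
  h.triple (Set.mul_mem_mul (Set.mul_mem_mul ha hs) hb)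

theorem IsCoset.mul3' {C : Set S} (h : T.IsCoset C) {a s b : S} (ha : a ∈ T.star C)
    (hs : s ∈ C) (hb : b ∈ T.star C) : a * s * b ∈ T.star C := by
  refine h.atlas.star.mul3 ha ?_ hb
  rwa [h.star_star]

/-- Every element `b` of a coset `C` dominates some `a ∈ C` via some `s ∈ C^*`. -/
theorem IsCoset.exists_dom {C : Set S} (h : T.IsCoset C) {b : S} (hb : b ∈ C) :
    ∃ a ∈ C, ∃ s ∈ T.star C, T.DomVia a s b := by
  rw [h.eq_up] at hb
  obtain ⟨a, ha, s, k⟩ := hb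
  exact ⟨a, ha, s, ⟨a, ha, b, k⟩, k⟩

theorem IsCoset.exists_dom' {C : Set S} (h : T.IsCoset C) {b : S} (hb : b ∈ T.star C) :
    ∃ a ∈ T.star C, ∃ s ∈ C, T.DomVia a s b := by
  have := h.atlas.star.exists_dom hb
  rwa [h.star_star] at this

theorem star_mul_subset {A B : Set S} (hA : T.IsAtlas A) (hB : T.IsAtlas B)
    (h : T.star A * A ⊆ T.up (B * T.star B)) : T.star (A * B) * A ⊆ T.star B := by
  have h1 : T.star A * A * B ⊆ T.up B :=
    (Set.mul_subset_mul h hB.round).trans ((up_mul_up _ _).trans (up_mono hB.triple))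
  have h2 : A ⊆ T.star (T.star A) := by rw [hA.star_star]; exact hA.round
  refine (Set.mul_subset_mul_left h2).trans ((star_mul_star _ _).trans ?_)
  rw [← mul_assoc, ← hB.star_up]
  exact star_mono h1

theorem mul_star_subset {A B : Set S} (hA : T.IsAtlas A) (hB : T.IsAtlas B)
    (h : B * T.star B ⊆ T.up (T.star A * A)) : B * T.star (A * B) ⊆ T.star A := by
  have h1 : A * (B * T.star B) ⊆ T.up A := by
    refine (Set.mul_subset_mul hA.round h).trans ((up_mul_up _ _).trans (up_mono ?_))
    rw [← mul_assoc]; exact hA.triple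
  have h2 : B ⊆ T.star (T.star B) := by rw [hB.star_star]; exact hB.round
  refine (Set.mul_subset_mul_right h2).trans ((star_mul_star _ _).trans ?_)
  rw [mul_assoc, ← hA.star_up]
  exact star_mono h1

theorem IsAtlas.mul {A B : Set S} (hA : T.IsAtlas A) (hB : T.IsAtlas B)
    (h : T.star A * A ⊆ T.up (B * T.star B)) : T.IsAtlas (A * B) := by
  constructor
  · calc A * B * T.star (A * B) * (A * B) = A * B * (T.star (A * B) * A) * B := by
          simp only [mul_assoc]
      _ ⊆ A * B * T.star B * B :=
          Set.mul_subset_mul_right (Set.mul_subset_mul_left (star_mul_subset hA hB h))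
      _ = A * (B * T.star B * B) := by simp only [mul_assoc]
      _ ⊆ A * B := Set.mul_subset_mul_left hB.triple
  · exact (Set.mul_subset_mul hA.round hB.round).trans (up_mul_up _ _)

theorem up_up_mul {A B : Set S} (hA : A ⊆ T.up A) (hB : B ⊆ T.up B) :
    T.up (T.up A * B) = T.up (A * B) :=
  Set.Subset.antisymm
    ((up_mono ((Set.mul_subset_mul_left hB).trans (up_mul_up _ _))).trans (up_up _))
    (up_mono (Set.mul_subset_mul_right hA))

theorem up_mul_up' {A B : Set S} (hA : A ⊆ T.up A) (hB : B ⊆ T.up B) :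
    T.up (A * T.up B) = T.up (A * B) :=
  Set.Subset.antisymm
    ((up_mono ((Set.mul_subset_mul_right hA).trans (up_mul_up _ _))).trans (up_up _))
    (up_mono (Set.mul_subset_mul_left hB))

theorem IsAtlas.round_mul {A B : Set S} (hA : A ⊆ T.up A) (hB : B ⊆ T.up B) :
    A * B ⊆ T.up (A * B) :=
  (Set.mul_subset_mul hA hB).trans (up_mul_up _ _)

/-! ## The coset groupoid -/

variable (T)

/-- The set `𝒞(S)` of non-empty cosets. -/
def Coset : Type _ := {C : Set S // T.IsCoset C ∧ C.Nonempty}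

variable {T}

namespace Coset

/-- The elements of a coset. -/
def carrier (C : T.Coset) : Set S := C.1

theorem isCoset (C : T.Coset) : T.IsCoset C.carrier := C.2.1

theorem nonempty (C : T.Coset) : C.carrier.Nonempty := C.2.2

theorem ext {C D : T.Coset} (h : C.carrier = D.carrier) : C = D := Subtype.ext h

theorem round (C : T.Coset) : C.carrier ⊆ T.up C.carrier := C.isCoset.atlas.round

/-- The inverse `C^*`. -/
def inv (C : T.Coset) : T.Coset :=
  ⟨T.star C.carrier, C.isCoset.atlas.star, by
    obtain ⟨c, hc⟩ := C.nonempty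
    obtain ⟨_, _, s, hs, _⟩ := C.isCoset.exists_dom hc
    exact ⟨s, hs⟩⟩

/-- The product `B · C` is defined, i.e. `s(B) = (B^*B)^<` is equal to `r(C) = (CC^*)^<`. -/
def Composable (B C : T.Coset) : Prop :=
  T.up (T.star B.carrier * B.carrier) = T.up (C.carrier * T.star C.carrier)

theorem Composable.subset {B C : T.Coset} (h : B.Composable C) :
    T.star B.carrier * B.carrier ⊆ T.up (C.carrier * T.star C.carrier) := by
  rw [← h]; exact IsAtlas.round_mul B.inv.round B.round

theorem Composable.subset' {B C : T.Coset} (h : B.Composable C) :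
    C.carrier * T.star C.carrier ⊆ T.up (T.star B.carrier * B.carrier) := by
  rw [h]; exact IsAtlas.round_mul C.round C.inv.round

/-- The product `B · C = (BC)^<`, when it is defined. -/
def prod (B C : T.Coset) (h : B.Composable C) : T.Coset :=
  ⟨T.up (B.carrier * C.carrier), (B.isCoset.atlas.mul C.isCoset.atlas h.subset).up,
    (B.nonempty.mul C.nonempty).mono (IsAtlas.round_mul B.round C.round)⟩

open Classical in
/-- The product, with a meaningless value where it is not defined. -/
noncomputable def mul (B C : T.Coset) : T.Coset :=
  if h : B.Composable C then B.prod C h else B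

theorem inv_carrier (C : T.Coset) : C.inv.carrier = T.star C.carrier := rfl

theorem mul_carrier {B C : T.Coset} (h : B.Composable C) :
    (B.mul C).carrier = T.up (B.carrier * C.carrier) := by
  unfold mul; rw [dif_pos h]; rfl

theorem inv_inv (C : T.Coset) : C.inv.inv = C := ext C.isCoset.star_star

theorem star_inv (C : T.Coset) : T.star C.inv.carrier = C.carrier := C.isCoset.star_star

theorem composable_inv_left (C : T.Coset) : C.inv.Composable C := by
  unfold Composable; rw [star_inv, inv_carrier]

theorem composable_inv_right (C : T.Coset) : C.Composable C.inv := by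
  unfold Composable; rw [star_inv, inv_carrier]

theorem comp_iff {B C : T.Coset} : mul (inv B) B = mul C (inv C) ↔ B.Composable C := by
  constructor
  · intro h
    have := congrArg carrier h
    rwa [mul_carrier B.composable_inv_left, mul_carrier C.composable_inv_right] at this
  · intro h
    apply ext
    rw [mul_carrier B.composable_inv_left, mul_carrier C.composable_inv_right]
    exact h

theorem star_mul {B C : T.Coset} (h : B.Composable C) :
    T.star (B.mul C).carrier = T.star (B.carrier * C.carrier) := by
  rw [mul_carrier h, (B.isCoset.atlas.mul C.isCoset.atlas h.subset).star_up]

theorem Composable.inv {B C : T.Coset} (h : B.Composable C) : C.inv.Composable B.inv := by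
  unfold Composable at h ⊢
  rw [star_inv, star_inv, inv_carrier, inv_carrier, h]

/-- `(B · C)^* = C^* · B^*`. -/
theorem inv_mul {B C : T.Coset} (h : B.Composable C) :
    (B.mul C).inv = C.inv.mul B.inv := by
  apply ext
  rw [inv_carrier, star_mul h, mul_carrier h.inv, inv_carrier, inv_carrier]
  have hat := B.isCoset.atlas.mul C.isCoset.atlas h.subset
  apply Set.Subset.antisymm
  · intro y hy
    rw [hat.star.eq_up] at hy
    obtain ⟨y0, hy0, k⟩ := hy
    obtain ⟨d, hd⟩ := B.nonempty
    obtain ⟨b, hb, b', hb', hdom⟩ := B.isCoset.exists_dom hd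
    refine ⟨y0 * (b * b'), ?_, k.mul_n hdom.as_mem⟩
    rw [← mul_assoc]
    exact Set.mul_mem_mul (star_mul_subset B.isCoset.atlas C.isCoset.atlas h.subset
      (Set.mul_mem_mul hy0 hb)) hb'
  · rw [hat.star.eq_up]
    exact up_mono (star_mul_star _ _)

theorem rng_mul {B C : T.Coset} (h : B.Composable C) :
    T.up ((B.mul C).carrier * T.star (B.mul C).carrier) =
      T.up (B.carrier * T.star B.carrier) := by
  have hat := B.isCoset.atlas.mul C.isCoset.atlas h.subset
  rw [star_mul h, mul_carrier h, up_up_mul hat.round hat.star.atlas.round]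
  apply Set.Subset.antisymm
  · apply up_mono
    rw [mul_assoc]
    exact Set.mul_subset_mul_left (mul_star_subset B.isCoset.atlas C.isCoset.atlas h.subset')
  · have key : B.carrier * T.star B.carrier ⊆
        T.up (T.up (B.carrier * C.carrier * T.star (B.carrier * C.carrier))) := by
      rintro _ ⟨b, hb, b', hb', rfl⟩
      obtain ⟨b2, hb2, t, ht, d2⟩ := B.isCoset.exists_dom hb
      obtain ⟨b3, hb3, d3⟩ := B.round hb
      obtain ⟨b0', hb0', d0⟩ := B.inv.round hb'
      obtain ⟨b1', hb1', d1⟩ := B.inv.round hb0'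
      obtain ⟨_, ⟨c, hc, c', hc', rfl⟩, dc⟩ := h.subset (Set.mul_mem_mul ht hb2)
      refine ⟨b2 * b0', ⟨b3 * (c * c') * b1', ?_, ?_⟩, Dom.mul ⟨t, d2⟩ d0⟩
      · have : b3 * (c * c') * b1' = (b3 * c) * (c' * b1') := by simp only [mul_assoc]
        rw [this]
        exact Set.mul_mem_mul (Set.mul_mem_mul hb3 hc)
          (star_mul_star _ _ (Set.mul_mem_mul hc' hb1'))
      · have := (d3.mul dc).mul d1
        simp only [← mul_assoc, d2.right] at this ⊢
        exact this
    exact (up_mono key).trans ((up_up _).trans (up_up _))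

theorem src_mul {B C : T.Coset} (h : B.Composable C) :
    T.up (T.star (B.mul C).carrier * (B.mul C).carrier) =
      T.up (T.star C.carrier * C.carrier) := by
  have := rng_mul h.inv
  rw [← inv_mul h, star_inv, star_inv] at this
  exact this

theorem Composable.mul_left {B C D : T.Coset} (h : B.Composable C) (k : C.Composable D) :
    (B.mul C).Composable D := by
  unfold Composable; rw [src_mul h]; exact k

theorem Composable.mul_right {B C D : T.Coset} (h : B.Composable C) (k : C.Composable D) :
    B.Composable (C.mul D) := by
  unfold Composable; rw [rng_mul k]; exact h

theorem mul_assoc' {B C D : T.Coset} (h : B.Composable C) (k : C.Composable D) :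
    (B.mul C).mul D = B.mul (C.mul D) := by
  apply ext
  rw [mul_carrier (h.mul_left k), mul_carrier (h.mul_right k), mul_carrier h, mul_carrier k,
    up_up_mul (IsAtlas.round_mul B.round C.round) D.round,
    up_mul_up' B.round (IsAtlas.round_mul C.round D.round), mul_assoc]

theorem inv_mul_mul {B C : T.Coset} (h : B.Composable C) : B.inv.mul (B.mul C) = C := by
  apply ext
  rw [mul_carrier (B.composable_inv_left.mul_right h), mul_carrier h,
    up_mul_up' B.inv.round (IsAtlas.round_mul B.round C.round), inv_carrier, ← mul_assoc]
  apply Set.Subset.antisymm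
  · refine (up_mono ((Set.mul_subset_mul h.subset C.round).trans (up_mul_up _ _))).trans ?_
    refine (up_up _).trans ((up_mono C.isCoset.triple).trans ?_)
    rw [← C.isCoset.eq_up]
  · intro c hc
    obtain ⟨c1, hc1, d⟩ := C.round hc
    obtain ⟨b0, hb0⟩ := B.nonempty
    obtain ⟨b, hb, b', hb', k⟩ := B.isCoset.exists_dom hb0
    exact ⟨b' * b * c1, Set.mul_mem_mul (Set.mul_mem_mul hb' hb) hc1, d.n_mul k.sa_mem⟩

theorem mul_mul_inv {B C : T.Coset} (h : B.Composable C) : (B.mul C).mul C.inv = B := by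
  have := inv_mul_mul h.inv
  rw [← inv_mul h, inv_inv] at this
  have hc : C.Composable (B.mul C).inv := by
    rw [inv_mul h]; exact C.composable_inv_right.mul_right h.inv
  have h2 := congrArg inv this
  rwa [inv_inv, inv_mul hc, inv_inv] at h2

end Coset

noncomputable instance : ArrowGroupoid T.Coset where
  inv := Coset.inv
  mul := Coset.mul
  inv_inv := Coset.inv_inv
  assoc g h k hgh hhk := by
    rw [Coset.comp_iff] at hgh hhk
    exact ⟨Coset.comp_iff.2 (hgh.mul_left hhk), Coset.comp_iff.2 (hgh.mul_right hhk),
      Coset.mul_assoc' hgh hhk⟩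
  inv_mul_mul _ _ h := Coset.inv_mul_mul (Coset.comp_iff.1 h)
  mul_mul_inv _ _ h := Coset.mul_mul_inv (Coset.comp_iff.1 h)

variable (T) in
/-- `𝒞_a`, the set of non-empty cosets containing `a`. -/
def cosetsAt (a : S) : Set T.Coset := {C | a ∈ C.carrier}

/-- The topology on `𝒞(S)` generated by the sets `𝒞_a`. -/
instance : TopologicalSpace T.Coset :=
  TopologicalSpace.generateFrom (Set.range T.cosetsAt)

/-! ## The coset bundle -/

variable (T) in
/-- `a ∼_A b`: there are `s, t ∈ A^*` with `sat = sbt`. -/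
def Equivalent (A : Set S) (a b : S) : Prop :=
  ∃ s ∈ T.star A, ∃ t ∈ T.star A, s * a * t = s * b * t

variable (T) in
/-- The set `𝒞̃(S)` of pairs `[c, C]` of a coset `C` and the `∼_C`-equivalence class of some
`c ∈ C`. -/
@[ext]
structure Germ where
  cls : Set S
  coset : T.Coset
  exists_rep : ∃ c ∈ coset.carrier, cls = {b ∈ coset.carrier | T.Equivalent coset.carrier c b}

namespace Germ

/-- `[c, C]`. -/
def mk' (c : S) (C : T.Coset) (hc : c ∈ C.carrier) : T.Germ :=
  ⟨{b ∈ C.carrier | T.Equivalent C.carrier c b}, C, c, hc, rfl⟩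

/-- Some `c` such that the given element is `[c, C]`. -/
noncomputable def rep (x : T.Germ) : S := x.exists_rep.choose

theorem rep_mem (x : T.Germ) : x.rep ∈ x.coset.carrier := x.exists_rep.choose_spec.1

theorem mk_rep (x : T.Germ) : mk' x.rep x.coset x.rep_mem = x :=
  Germ.ext x.exists_rep.choose_spec.2.symm rfl

theorem exists_common {C : T.Coset} {u v : S} (hu : u ∈ T.star C.carrier)
    (hv : v ∈ T.star C.carrier) :
    ∃ w ∈ T.star C.carrier, ∃ p q, w = u * p ∧ w = v * q := by
  obtain ⟨_, _, m, hm, du⟩ := C.isCoset.exists_dom' hu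
  obtain ⟨_, _, n, hn, dv⟩ := C.isCoset.exists_dom' hv
  refine ⟨u * m * (v * n) * u, ?_, m * (v * n) * u, n * (u * m) * u, ?_, ?_⟩
  · have := C.isCoset.mul3' (C.isCoset.mul3' hu hm hv) hn hu
    simpa only [mul_assoc] using this
  · simp only [mul_assoc]
  · rw [zz du.bs_mem dv.bs_mem]; simp only [mul_assoc]

/-- If `C ∋ d <_s c` then `sc` fixes some `u ∈ C^*`. -/
theorem exists_fix {C : T.Coset} {d s c : S} (hd : d ∈ C.carrier) (h : T.DomVia d s c) :
    ∃ u ∈ T.star C.carrier, s * c * u = u := by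
  have hs : s ∈ T.star C.carrier := ⟨d, hd, c, h⟩
  obtain ⟨_, _, f, hf, k⟩ := C.isCoset.exists_dom hd
  refine ⟨f * d * s, C.isCoset.mul3' hf hd hs, ?_⟩
  calc s * c * (f * d * s) = (s * c) * (f * d) * s := by simp only [mul_assoc]
    _ = (f * d) * (s * c) * s := by rw [zz h.sb_mem k.sb_mem]
    _ = f * (d * s * c) * s := by simp only [mul_assoc]
    _ = f * d * s := by rw [h.left]

theorem equivalent_of {C : T.Coset} {a b u : S} (hu : u ∈ T.star C.carrier)
    (h : a * u = b * u) : T.Equivalent C.carrier a b :=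
  ⟨u, hu, u, hu, by rw [mul_assoc, h, mul_assoc]⟩

theorem exists_fix_conj {C : T.Coset} {a0 a' a z c : S} (h0 : a0 ∈ C.carrier)
    (h : T.DomVia a0 a' a) (hz : z ∈ T.Z) (hc : c ∈ C.carrier) (hzc : z * c = c) :
    ∃ u ∈ T.star C.carrier, a' * z * a * u = u := by
  have ha' : a' ∈ T.star C.carrier := ⟨a0, h0, a, h⟩
  have hq : a' * z * a ∈ T.Z := (T.binormal a a' h.bs_mem h.sb_mem z hz).2
  obtain ⟨_, _, f, hf, k⟩ := C.isCoset.exists_dom h0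
  refine ⟨f * a0 * a' * c * f,
    C.isCoset.mul3' (C.isCoset.mul3' hf h0 ha') hc hf, ?_⟩
  calc a' * z * a * (f * a0 * a' * c * f)
      = (a' * z * a) * (f * a0) * (a' * c * f) := by simp only [mul_assoc]
    _ = (f * a0) * (a' * z * a) * (a' * c * f) := by rw [zz hq k.sb_mem]
    _ = f * a0 * a' * (z * (a * a')) * c * f := by simp only [mul_assoc]
    _ = f * a0 * a' * ((a * a') * z) * c * f := by rw [zz hz h.bs_mem]
    _ = f * (a0 * a' * a) * a' * (z * c) * f := by simp only [mul_assoc]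
    _ = f * a0 * a' * c * f := by rw [h.left, hzc]

/-- If `a ∼_C b` then `au = bu` for some `u ∈ C^*`. -/
theorem Equivalent.exists_right {C : T.Coset} {a b : S} (ha : a ∈ C.carrier)
    (hb : b ∈ C.carrier) (h : T.Equivalent C.carrier a b) :
    ∃ u ∈ T.star C.carrier, a * u = b * u := by
  obtain ⟨s, hs, t, ht, e⟩ := h
  obtain ⟨a0, ha0, a', ha', da⟩ := C.isCoset.exists_dom ha
  obtain ⟨b0, hb0, b', hb', db⟩ := C.isCoset.exists_dom hb
  obtain ⟨s2, hs2, s1, hs1, ds⟩ := C.isCoset.exists_dom' hs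
  obtain ⟨t2, ht2, t1, ht1, dt⟩ := C.isCoset.exists_dom' ht
  -- `z = s1 * s` fixes an element of `C` on the left
  have hz : s1 * s ∈ T.Z := ds.sb_mem
  have hy : t * t1 ∈ T.Z := dt.bs_mem
  have hc : s1 * s2 * s1 ∈ C.carrier := C.isCoset.mul3 hs1 hs2 hs1
  have hzc : s1 * s * (s1 * s2 * s1) = s1 * s2 * s1 := by
    calc s1 * s * (s1 * s2 * s1) = s1 * (s * s1 * s2) * s1 := by simp only [mul_assoc]
      _ = _ := by rw [ds.right]
  obtain ⟨u1, hu1, f1⟩ := exists_fix_conj ha0 da hz hc hzc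
  obtain ⟨u2, hu2, f2⟩ := exists_fix_conj hb0 db hz hc hzc
  obtain ⟨u3, hu3, f3⟩ := exists_fix ha0 da
  obtain ⟨u4, hu4, f4⟩ := exists_fix hb0 db
  have f5 : t * t1 * t2 = t2 := dt.right
  obtain ⟨v1, hv1, p1, q1, e1, e1'⟩ := exists_common hu1 hu2
  obtain ⟨v2, hv2, p2, q2, e2, e2'⟩ := exists_common hu3 hu4
  obtain ⟨v3, hv3, p3, q3, e3, e3'⟩ := exists_common hv1 hv2
  obtain ⟨w, hw, p4, q4, e4, e4'⟩ := exists_common hv3 ht2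
  have g1 : a' * (s1 * s) * a * w = w := by
    rw [e4, e3, e1]; simp only [← mul_assoc] at f1 ⊢; rw [f1]
  have g2 : b' * (s1 * s) * b * w = w := by
    rw [e4, e3, e1']; simp only [← mul_assoc] at f2 ⊢; rw [f2]
  have g3 : a' * a * w = w := by
    rw [e4, e3', e2]; simp only [← mul_assoc] at f3 ⊢; rw [f3]
  have g4 : b' * b * w = w := by
    rw [e4, e3', e2']; simp only [← mul_assoc] at f4 ⊢; rw [f4]
  have g5 : t * t1 * w = w := by
    rw [e4']; simp only [← mul_assoc] at f5 ⊢; rw [f5]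
  refine ⟨w, hw, ?_⟩
  have ka : a * w = s1 * s * a * t * (t1 * w) := by
    calc a * w = a * (a' * (s1 * s) * a * w) := by rw [g1]
      _ = ((a * a') * (s1 * s)) * (a * w) := by simp only [mul_assoc]
      _ = ((s1 * s) * (a * a')) * (a * w) := by rw [zz da.bs_mem hz]
      _ = s1 * s * a * (a' * a * w) := by simp only [mul_assoc]
      _ = s1 * s * a * (t * t1 * w) := by rw [g3, g5]
      _ = _ := by simp only [mul_assoc]
  have kb : b * w = s1 * s * b * t * (t1 * w) := by
    calc b * w = b * (b' * (s1 * s) * b * w) := by rw [g2]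
      _ = ((b * b') * (s1 * s)) * (b * w) := by simp only [mul_assoc]
      _ = ((s1 * s) * (b * b')) * (b * w) := by rw [zz db.bs_mem hz]
      _ = s1 * s * b * (b' * b * w) := by simp only [mul_assoc]
      _ = s1 * s * b * (t * t1 * w) := by rw [g4, g5]
      _ = _ := by simp only [mul_assoc]
  rw [ka, kb]
  have : s1 * s * a * t = s1 * s * b * t := by
    simp only [mul_assoc] at e ⊢; rw [e]
  rw [this]

theorem equivalent_refl (C : T.Coset) (a : S) : T.Equivalent C.carrier a a := by
  obtain ⟨u, hu⟩ := C.inv.nonempty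
  exact equivalent_of hu rfl

theorem equivalent_symm {C : T.Coset} {a b : S} (h : T.Equivalent C.carrier a b) :
    T.Equivalent C.carrier b a := by
  obtain ⟨s, hs, t, ht, e⟩ := h
  exact ⟨s, hs, t, ht, e.symm⟩

theorem equivalent_trans {C : T.Coset} {a b c : S} (ha : a ∈ C.carrier) (hb : b ∈ C.carrier)
    (hc : c ∈ C.carrier) (h : T.Equivalent C.carrier a b) (k : T.Equivalent C.carrier b c) :
    T.Equivalent C.carrier a c := by
  obtain ⟨u, hu, e⟩ := Equivalent.exists_right ha hb h
  obtain ⟨v, hv, f⟩ := Equivalent.exists_right hb hc k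
  obtain ⟨w, hw, p, q, rfl, e2⟩ := exists_common hu hv
  refine equivalent_of hw ?_
  rw [← mul_assoc, e, mul_assoc, e2, ← mul_assoc, f, mul_assoc]

/-- `[a, C] = [b, C]` iff `a ∼_C b`. -/
theorem mk_eq_mk {C : T.Coset} {a b : S} (ha : a ∈ C.carrier) (hb : b ∈ C.carrier) :
    mk' a C ha = mk' b C hb ↔ T.Equivalent C.carrier a b := by
  constructor
  · intro h
    have h1 : b ∈ (mk' b C hb).cls := ⟨hb, equivalent_refl C b⟩
    rw [← h] at h1
    exact h1.2
  · intro h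
    refine Germ.ext (Set.ext fun c => ?_) rfl
    exact ⟨fun k => ⟨k.1, equivalent_trans hb ha k.1 (equivalent_symm h) k.2⟩,
      fun k => ⟨k.1, equivalent_trans ha hb k.1 h k.2⟩⟩

theorem mul_mem {A B : T.Coset} (h : A.Composable B) {a b : S} (ha : a ∈ A.carrier)
    (hb : b ∈ B.carrier) : a * b ∈ (A.mul B).carrier := by
  rw [Coset.mul_carrier h]
  exact IsAtlas.round_mul A.round B.round (Set.mul_mem_mul ha hb)

open Classical in
/-- The product `[a, A][b, B] = [ab, A · B]` when `s(A) = r(B)` (and a meaningless value where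
the product is not defined). -/
noncomputable def mul (x y : T.Germ) : T.Germ :=
  if h : x.coset.Composable y.coset then
    mk' (x.rep * y.rep) (x.coset.mul y.coset) (mul_mem h x.rep_mem y.rep_mem)
  else x

theorem exists_inv_rep (x : T.Germ) :
    ∃ s, ∃ d ∈ x.coset.carrier, T.DomVia d s x.rep := by
  obtain ⟨d, hd, s, _, h⟩ := x.coset.isCoset.exists_dom x.rep_mem
  exact ⟨s, d, hd, h⟩

theorem mem_inv {C : T.Coset} {d s c : S} (hd : d ∈ C.carrier) (h : T.DomVia d s c) :
    s ∈ C.inv.carrier := ⟨d, hd, c, h⟩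

/-- The inverse `[c, C]⁻¹ = [c', C^*]`, for any `c'` with `C ∋ d <_{c'} c`. -/
noncomputable def inv (x : T.Germ) : T.Germ :=
  mk' x.exists_inv_rep.choose x.coset.inv
    (mem_inv x.exists_inv_rep.choose_spec.choose_spec.1
      x.exists_inv_rep.choose_spec.choose_spec.2)

theorem equivalent_rep {C : T.Coset} {c : S} (hc : c ∈ C.carrier) :
    T.Equivalent C.carrier (mk' c C hc).rep c :=
  (mk_eq_mk (mk' c C hc).rep_mem hc).1 (mk_rep (mk' c C hc))

theorem equivalent_mul {A B : T.Coset} (h : A.Composable B) {a c b d : S}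
    (ha : a ∈ A.carrier) (hc : c ∈ A.carrier) (hb : b ∈ B.carrier) (hd : d ∈ B.carrier)
    (k : T.Equivalent A.carrier a c) (l : T.Equivalent B.carrier b d) :
    T.Equivalent (A.mul B).carrier (a * b) (c * d) := by
  obtain ⟨u, hu, e⟩ := Equivalent.exists_right ha hc k
  obtain ⟨t, ht, f⟩ := Equivalent.exists_right hb hd l
  obtain ⟨b0, hb0, b', hb', db⟩ := B.isCoset.exists_dom hb
  obtain ⟨_, _, m, hm, du⟩ := A.isCoset.exists_dom' hu
  have hst : T.star B.carrier * T.star A.carrier ⊆ T.star (A.mul B).carrier := by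
    rw [Coset.star_mul h]; exact star_mul_star _ _
  refine equivalent_trans (b := c * b) (mul_mem h ha hb) (mul_mem h hc hb) (mul_mem h hc hd)
    ?_ ?_
  · refine equivalent_of (hst (Set.mul_mem_mul hb' (A.isCoset.mul3' hu hm hu))) ?_
    have key : b * (b' * (u * m * u)) = u * (m * (b * b') * u) := by
      calc b * (b' * (u * m * u)) = (b * b') * (u * m) * u := by simp only [mul_assoc]
        _ = (u * m) * (b * b') * u := by rw [zz db.bs_mem du.bs_mem]
        _ = _ := by simp only [mul_assoc]
    rw [mul_assoc, key, ← mul_assoc, e, mul_assoc, ← key, ← mul_assoc]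
  · refine equivalent_of (hst (Set.mul_mem_mul ht hu)) ?_
    rw [mul_assoc, ← mul_assoc b, f, mul_assoc, mul_assoc]

theorem mk_congr {a b : S} {A B : T.Coset} (hA : A = B) {ha : a ∈ A.carrier}
    {hb : b ∈ B.carrier} (h : T.Equivalent B.carrier a b) : mk' a A ha = mk' b B hb := by
  subst hA; exact (mk_eq_mk ha hb).2 h

theorem mul_coset {x y : T.Germ} (h : x.coset.Composable y.coset) :
    (mul x y).coset = x.coset.mul y.coset := by
  unfold mul; rw [dif_pos h]; rfl

theorem mk_mul_mk {A B : T.Coset} (h : A.Composable B) {a b : S} (ha : a ∈ A.carrier)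
    (hb : b ∈ B.carrier) :
    mul (mk' a A ha) (mk' b B hb) = mk' (a * b) (A.mul B) (mul_mem h ha hb) := by
  have h' : (mk' a A ha).coset.Composable (mk' b B hb).coset := h
  unfold mul; rw [dif_pos h']
  exact (mk_eq_mk _ _).2 (equivalent_mul h (rep_mem (mk' a A ha)) ha (rep_mem (mk' b B hb)) hb
    (equivalent_rep ha) (equivalent_rep hb))

theorem equivalent_inv {C : T.Coset} {d s c f t e : S} (hd : d ∈ C.carrier)
    (h : T.DomVia d s c) (hf : f ∈ C.carrier) (k : T.DomVia f t e)
    (l : T.Equivalent C.carrier c e) : T.Equivalent C.inv.carrier s t := by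
  have hc : c ∈ C.carrier := C.isCoset.up_mem hd ⟨s, h⟩
  have he : e ∈ C.carrier := C.isCoset.up_mem hf ⟨t, k⟩
  obtain ⟨u, hu, e0⟩ := Equivalent.exists_right hc he l
  obtain ⟨u1, hu1, f1⟩ := exists_fix hd h
  obtain ⟨u2, hu2, f2⟩ := exists_fix hf k
  obtain ⟨v, hv, p1, q1, e1, e1'⟩ := exists_common hu1 hu2
  obtain ⟨w, hw, p2, q2, e2, e2'⟩ := exists_common hu hv
  refine equivalent_of (u := c * w * c) ?_ ?_
  · rw [Coset.star_inv]; exact C.isCoset.mul3 hc hw hc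
  · have g0 : c * w = e * w := by rw [e2, ← mul_assoc, e0, mul_assoc]
    have g1 : s * c * w = w := by
      rw [e2', e1]; simp only [← mul_assoc] at f1 ⊢; rw [f1]
    have g2 : t * e * w = w := by
      rw [e2', e1']; simp only [← mul_assoc] at f2 ⊢; rw [f2]
    have g3 : s * (c * w) = t * (c * w) := by
      rw [← mul_assoc, g1, g0, ← mul_assoc, g2]
    rw [← mul_assoc, g3, mul_assoc]

theorem inv_mk {C : T.Coset} {d s c : S} (hd : d ∈ C.carrier) (h : T.DomVia d s c)
    (hc : c ∈ C.carrier) : inv (mk' c C hc) = mk' s C.inv (mem_inv hd h) := by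
  have k := (mk' c C hc).exists_inv_rep.choose_spec.choose_spec
  exact (mk_eq_mk _ _).2 (equivalent_inv k.1 k.2 hd h (equivalent_rep hc))

theorem exists_mk (x : T.Germ) : ∃ c C, ∃ hc : c ∈ C.carrier, ∃ d ∈ C.carrier, ∃ s,
    T.DomVia d s c ∧ x = mk' c C hc := by
  obtain ⟨s, d, hd, h⟩ := x.exists_inv_rep
  exact ⟨x.rep, x.coset, x.rep_mem, d, hd, s, h, x.mk_rep.symm⟩

theorem inv_inv (x : T.Germ) : inv (inv x) = x := by
  obtain ⟨a, A, ha, d, hd, s, h, rfl⟩ := x.exists_mk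
  have hs := mem_inv hd h
  obtain ⟨e, he, t, _, k⟩ := A.inv.isCoset.exists_dom hs
  rw [inv_mk hd h, inv_mk he k]
  refine mk_congr A.inv_inv (equivalent_of (u := e * d * s) (A.isCoset.mul3' he hd hs) ?_)
  have key : a * e * d = t * e * d := by
    calc a * e * d = a * (s * t * e) * d := by rw [k.right]
      _ = (a * s) * (t * e) * d := by simp only [mul_assoc]
      _ = (t * e) * (a * s) * d := by rw [zn h.bs_mem k.sa_mem]
      _ = t * e * (a * s * d) := by simp only [mul_assoc]
      _ = _ := by rw [h.right]
  calc t * (e * d * s) = t * e * d * s := by simp only [mul_assoc]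
    _ = a * e * d * s := by rw [key]
    _ = _ := by simp only [mul_assoc]

theorem comp_iff {x y : T.Germ} :
    mul (inv x) x = mul y (inv y) ↔ x.coset.Composable y.coset := by
  obtain ⟨a, A, ha, d, hd, s, h, rfl⟩ := x.exists_mk
  obtain ⟨b, B, hb, e, he, t, k, rfl⟩ := y.exists_mk
  rw [inv_mk hd h, inv_mk he k, mk_mul_mk A.composable_inv_left,
    mk_mul_mk B.composable_inv_right]
  constructor
  · intro l
    exact Coset.comp_iff.1 (congrArg Germ.coset l)
  · intro l
    have hAB : A.inv.mul A = B.mul B.inv := Coset.comp_iff.2 l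
    refine mk_congr hAB ?_
    obtain ⟨u, hu, f⟩ := exists_fix hd h
    have h1 : u * a ∈ T.star (B.mul B.inv).carrier := by
      rw [← hAB, ← Coset.inv_carrier, Coset.inv_mul A.composable_inv_left, Coset.inv_inv]
      exact mul_mem A.composable_inv_left hu ha
    have h2 : e * t ∈ T.star (B.mul B.inv).carrier := by
      rw [← Coset.inv_carrier, Coset.inv_mul B.composable_inv_right, Coset.inv_inv]
      exact mul_mem B.composable_inv_right he (mem_inv he k)
    obtain ⟨w, hw, p, q, e1, e2⟩ := exists_common h1 h2
    refine equivalent_of hw ?_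
    have g1 : s * a * w = w := by
      rw [e1]; simp only [← mul_assoc] at f ⊢; rw [f]
    have g2 : b * t * w = w := by
      have f2 := k.right
      rw [e2]; simp only [← mul_assoc] at f2 ⊢; rw [f2]
    rw [g1, g2]

theorem mul_assoc' {x y z : T.Germ} (h : x.coset.Composable y.coset)
    (k : y.coset.Composable z.coset) : mul (mul x y) z = mul x (mul y z) := by
  obtain ⟨a, A, ha, -, -, -, -, rfl⟩ := x.exists_mk
  obtain ⟨b, B, hb, -, -, -, -, rfl⟩ := y.exists_mk
  obtain ⟨c, C, hc, -, -, -, -, rfl⟩ := z.exists_mk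
  replace h : A.Composable B := h
  replace k : B.Composable C := k
  rw [mk_mul_mk h, mk_mul_mk k, mk_mul_mk (h.mul_left k), mk_mul_mk (h.mul_right k)]
  refine mk_congr (Coset.mul_assoc' h k) ?_
  rw [mul_assoc]
  exact equivalent_refl _ _

theorem inv_mul_mul {x y : T.Germ} (l : x.coset.Composable y.coset) :
    mul (inv x) (mul x y) = y := by
  obtain ⟨a, A, ha, d, hd, s, h, rfl⟩ := x.exists_mk
  obtain ⟨b, B, hb, e, he, t, k, rfl⟩ := y.exists_mk
  replace l : A.Composable B := l
  rw [inv_mk hd h, mk_mul_mk l, mk_mul_mk (A.composable_inv_left.mul_right l)]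
  refine mk_congr (Coset.inv_mul_mul l) ?_
  obtain ⟨u, hu, f⟩ := exists_fix hd h
  have ht := mem_inv he k
  have hm : t * (u * a) ∈ T.star B.carrier := by
    obtain ⟨t0, ht0, dt⟩ := B.inv.round ht
    obtain ⟨_, ⟨b1, hb1, t1, ht1, rfl⟩, du⟩ := l.subset (Set.mul_mem_mul hu ha)
    refine B.inv.isCoset.up_mem ?_ (dt.mul du)
    have := B.isCoset.mul3' ht0 hb1 ht1
    rwa [mul_assoc] at this
  refine equivalent_of hm ?_
  calc s * (a * b) * (t * (u * a)) = (s * a) * (b * t) * (u * a) := by simp only [mul_assoc]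
    _ = (b * t) * (s * a) * (u * a) := by rw [zz h.sb_mem k.bs_mem]
    _ = b * t * (s * a * u) * a := by simp only [mul_assoc]
    _ = b * t * u * a := by rw [f]
    _ = b * (t * (u * a)) := by simp only [mul_assoc]

theorem mul_mul_inv {x y : T.Germ} (l : x.coset.Composable y.coset) :
    mul (mul x y) (inv y) = x := by
  obtain ⟨a, A, ha, d, hd, s, h, rfl⟩ := x.exists_mk
  obtain ⟨b, B, hb, e, he, t, k, rfl⟩ := y.exists_mk
  replace l : A.Composable B := l
  rw [inv_mk he k, mk_mul_mk l, mk_mul_mk (l.mul_left B.composable_inv_right)]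
  refine mk_congr (Coset.mul_mul_inv l) ?_
  have hs := mem_inv hd h
  have hm : e * t * s ∈ T.star A.carrier := by
    obtain ⟨s0, hs0, ds⟩ := A.inv.round hs
    obtain ⟨_, ⟨s1, hs1, a1, ha1, rfl⟩, du⟩ := l.subset' (Set.mul_mem_mul he (mem_inv he k))
    exact A.inv.isCoset.up_mem (A.isCoset.mul3' hs1 ha1 hs0) (du.mul ds)
  refine equivalent_of hm ?_
  calc a * b * t * (e * t * s) = a * (b * t * e) * t * s := by simp only [mul_assoc]
    _ = a * (e * t * s) := by rw [k.right]; simp only [mul_assoc]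

end Germ

noncomputable instance : ArrowGroupoid T.Germ where
  inv := Germ.inv
  mul := Germ.mul
  inv_inv := Germ.inv_inv
  assoc g h k hgh hhk := by
    rw [Germ.comp_iff] at hgh hhk
    refine ⟨Germ.comp_iff.2 ?_, Germ.comp_iff.2 ?_, Germ.mul_assoc' hgh hhk⟩
    · rw [Germ.mul_coset hgh]; exact hgh.mul_left hhk
    · rw [Germ.mul_coset hhk]; exact hgh.mul_right hhk
  inv_mul_mul _ _ h := Germ.inv_mul_mul (Germ.comp_iff.1 h)
  mul_mul_inv _ _ h := Germ.mul_mul_inv (Germ.comp_iff.1 h)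

/-- The topology on `𝒞̃(S)` generated by the sets `𝒞̃^s = {[s, C] : s ∈ C}` and
`𝒞̃_s = {[c, C] : c, s ∈ C}`, for `s ∈ S`. -/
instance : TopologicalSpace T.Germ :=
  TopologicalSpace.generateFrom
    (Set.range (fun s : S => {x : T.Germ | ∃ C, ∃ hs : s ∈ C.carrier, x = Germ.mk' s C hs}) ∪
      Set.range (fun s : S => {x : T.Germ | s ∈ x.coset.carrier}))

variable (T)

/-- The coset bundle `ρ : 𝒞̃(S) → 𝒞(S)`, `ρ([c, C]) = C`. -/
def cosetBundle : T.Germ → T.Coset := Germ.coset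

/-- The slice-section `ã`, with domain `𝒞_a` and `ã(C) = [a, C]`. -/
def tildeSection (a : S) : Set (T.Germ × T.Coset) :=
  {p | ∃ C, ∃ ha : a ∈ C.carrier, p = (Germ.mk' a C ha, C)}

/-! ## Representations -/

/-- Étale representations of `(S, N, Z)` on a groupoid `G`. -/
structure IsEtaleRep {G : Type*} [ArrowGroupoid G] [TopologicalSpace G] (θ : S → Set G) :
    Prop where
  etale : IsEtaleGroupoid G
  isOpen : ∀ a, IsOpen (θ a)
  isSlice : ∀ a, IsSlice (θ a)
  map_mul : ∀ a b, θ (a * b) = setMul (θ a) (θ b)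
  cover : ∀ g, ∃ a, g ∈ θ a
  map_N : ∀ n ∈ T.N, θ n ⊆ units G
  locally_round : ∀ g a, g ∈ θ a → ∃ b, T.Dom b a ∧ g ∈ θ b

/-- Bundle representations of `(S, N, Z)` on a groupoid bundle `π : F → G`. -/
structure IsBundleRep {F G : Type*} [ArrowGroupoid F] [TopologicalSpace F] [ArrowGroupoid G]
    [TopologicalSpace G] (π : F → G) (θ : S → Set (F × G)) : Prop where
  bundle : IsGroupoidBundle π
  isSliceSection : ∀ a, IsSliceSection π (θ a)
  map_mul : ∀ a b, θ (a * b) = sectionMul (θ a) (θ b)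
  etaleRep : T.IsEtaleRep (fun a => BinRel.dom (θ a))

/-- Universal bundle representations: every bundle representation `θ` (on bundles in any pair
of universes) is `(τ/φ) ∘ μ` for a unique Pierce morphism `(φ, τ)`. -/
def IsUniversalBundleRep {F : Type x} {G : Type y} [ArrowGroupoid F] [TopologicalSpace F]
    [ArrowGroupoid G] [TopologicalSpace G] (π : F → G) (μ : S → Set (F × G)) : Prop :=
  T.IsBundleRep π μ ∧
  ∀ (F' : Type v) (G' : Type w) [ArrowGroupoid F'] [TopologicalSpace F'] [ArrowGroupoid G']
    [TopologicalSpace G'] (π' : F' → G') (θ : S → Set (F' × G')), T.IsBundleRep π' θ →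
    ∃! m : Σ φ : Set (G × G'), (Pullback π φ → F'),
      IsPierce π π' m.1 m.2 ∧ ∀ a, θ a = fracAct m.1 m.2 (μ a)

end StructuredSemigroup

/-! Three things carry the proof: one-element rigidity of cosets, finiteness of witnesses, and the
coset of all elements of `S` defined at a given arrow.

Rigidity. A coset is recovered from any one of its elements together with its source or its range:
if `a`, `b` lie in `B` and `b₀ < b` in `B`, then `asb₀ < b` for a suitable `s ∈ B^*`, and `sb₀` lies
in the source. So each `cosetsAt a` is a slice. In the other direction, a unit coset `D` close to
the source of `C` is the source of a translate `(aD)^<` close to `C`, which makes the source map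
open.

Finiteness. Membership in an inverse or a product, and equality of germs, are each witnessed by
finitely many elements of the cosets involved. The same witnesses work in every coset containing
them, and this gives all the continuity statements.

Multiplicativity of `a ↦ ã` is where symmetry of `Z` enters. A coset containing `ab` must be
factored as `A · B` with `a ∈ A` and `b ∈ B`. Symmetry provides `s ∈ C^*` with `bsa ∈ Z`, so that
`sa` and `bs` can serve as local inverses of `b` and `a` (`Coset.exists_factor`).

Universality. Given `θ`, an arrow `g` determines `C_g = {a : g ∈ dom θ(a)}`. This is a coset because
elements of `N` live on units and domination `a <ₛ b` makes `s` defined at `g⁻¹` whenever `a` is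
defined at `g`. Then `φ` is the graph of `g ↦ C_g` and `τ([c, C_g], g) = θ(c)(g)`. The latter is
well defined: equivalent `c`, `d` satisfy `cu = du` for some `u ∈ C_g^*`, and the value of `θ(u)` at
`g⁻¹` cancels. Conversely, `θ(a) = (τ/φ)(ã)` for all `a` determines `φ` through the domains and then
`τ` through the values. -/

namespace ArrowGroupoid

/-! ### Elementary arrow calculus in a groupoid. -/

variable {G : Type*} [ArrowGroupoid G]

theorem src_inv (g : G) : src (inv g) = rng g := by
  unfold src rng; rw [inv_inv]

theorem rng_inv (g : G) : rng (inv g) = src g := by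
  unfold src rng; rw [inv_inv]

theorem comp_inv_right (g : G) : Comp g (inv g) := (rng_inv g).symm

theorem comp_inv_left (g : G) : Comp (inv g) g := src_inv g

theorem src_mul {g h : G} (k : Comp g h) : src (mul g h) = src h :=
  ((assoc g h (inv h) k (comp_inv_right h)).1).trans (rng_inv h)

theorem rng_mul {g h : G} (k : Comp g h) : rng (mul g h) = rng g :=
  ((assoc (inv g) g h (comp_inv_left g) k).2.1).symm.trans (src_inv g)

theorem src_src (g : G) : src (src g) = src g := src_mul (comp_inv_left g)

theorem rng_src (g : G) : rng (src g) = src g := (rng_mul (comp_inv_left g)).trans (rng_inv g)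

theorem src_rng (g : G) : src (rng g) = rng g := (src_mul (comp_inv_right g)).trans (src_inv g)

theorem mul_src (g : G) : mul g (src g) = g := by
  have := inv_mul_mul (inv g) g (comp_inv_left g)
  rwa [inv_inv] at this

theorem rng_mul_self (g : G) : mul (rng g) g = g := by
  have := mul_mul_inv g (inv g) (comp_inv_right g)
  rwa [inv_inv] at this

theorem src_mem_units (g : G) : src g ∈ units G := by
  have h := mul_src (src g)
  rw [src_src] at h
  exact ⟨(src_src g).trans (rng_src g).symm, h⟩

theorem rng_mem_units (g : G) : rng g ∈ units G := by
  rw [← src_inv]; exact src_mem_units _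

theorem src_of_mem_units {g : G} (h : g ∈ units G) : src g = g := by
  have := inv_mul_mul g g h.1
  rwa [h.2] at this

theorem rng_of_mem_units {g : G} (h : g ∈ units G) : rng g = g :=
  h.1.symm.trans (src_of_mem_units h)

theorem unit_mul {g h : G} (hg : g ∈ units G) (k : Comp g h) : mul g h = h := by
  have : g = rng h := (src_of_mem_units hg).symm.trans k
  rw [this, rng_mul_self]

theorem eq_inv_of_mul_mem_units {g h : G} (k : Comp g h) (hu : mul g h ∈ units G) :
    h = inv g := by
  have h1 : mul g h = src (inv g) := by
    rw [← rng_of_mem_units hu, rng_mul k, src_inv]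
  have h2 := inv_mul_mul g h k
  rwa [h1, mul_src, eq_comm] at h2

theorem mul_right_cancel_of_comp {e e' f : G} (h : Comp e f) (h' : Comp e' f)
    (k : mul e f = mul e' f) : e = e' := by
  rw [← mul_mul_inv e f h, k, mul_mul_inv e' f h']

end ArrowGroupoid

/-! ### Functors that are injective on units. -/

namespace IsIsocofibration

variable {F G : Type*} [ArrowGroupoid F] [ArrowGroupoid G] {π : F → G}

theorem map_units (h : IsIsocofibration π) {f : F} (hf : f ∈ units F) : π f ∈ units G := by
  have := h.map_mul f f hf.1
  rw [hf.2] at this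
  exact ⟨this.1, this.2.symm⟩

/-- Functors are only required to respect products, so inverses have to be recovered: `π(f⁻¹)π(f)`
is the image of a unit, hence a unit, and this forces `π(f⁻¹) = π(f)⁻¹`. -/
theorem map_src (h : IsIsocofibration π) (f : F) : π (src f) = src (π f) := by
  obtain ⟨k, e⟩ := h.map_mul (inv f) f (comp_inv_left f)
  have hu : mul (π (inv f)) (π f) ∈ units G := by
    rw [← e]; exact h.map_units (src_mem_units f)
  have : π (inv f) = inv (π f) := by
    rw [eq_inv_of_mul_mem_units k hu, ArrowGroupoid.inv_inv]
  rw [this] at e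
  exact e

theorem map_inv (h : IsIsocofibration π) (f : F) : π (inv f) = inv (π f) := by
  obtain ⟨k, e⟩ := h.map_mul f (inv f) (comp_inv_right f)
  refine eq_inv_of_mul_mem_units k ?_
  rw [← e]; exact h.map_units (rng_mem_units f)

theorem map_rng (h : IsIsocofibration π) (f : F) : π (rng f) = rng (π f) := by
  rw [← src_inv, h.map_src, h.map_inv, src_inv]

/-- Injectivity on units turns equality of source and range below into equality above. This is why
values of slice-sections can be multiplied as soon as their base points can. -/
theorem comp_of_map (h : IsIsocofibration π) {e f : F} (k : Comp (π e) (π f)) : Comp e f := by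
  refine h.injOn_units (src_mem_units e) (rng_mem_units f) ?_
  rw [h.map_src, h.map_rng]; exact k

end IsIsocofibration

namespace StructuredSemigroup

variable {S : Type u} [Semigroup S] {T : StructuredSemigroup S}

/-! ### Cosets: sources, ranges, slices and units. -/

namespace Coset

theorem src_carrier (C : T.Coset) : (src C).carrier = T.up (T.star C.carrier * C.carrier) :=
  mul_carrier C.composable_inv_left

theorem star_mul_mem_src {C : T.Coset} {s c : S} (hs : s ∈ T.star C.carrier)
    (hc : c ∈ C.carrier) : s * c ∈ (src C).carrier :=
  Germ.mul_mem C.composable_inv_left hs hc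

theorem mul_star_mem_rng {C : T.Coset} {s c : S} (hc : c ∈ C.carrier)
    (hs : s ∈ T.star C.carrier) : c * s ∈ (rng C).carrier :=
  Germ.mul_mem C.composable_inv_right hc hs

theorem mul_mem_of_comp {B C : T.Coset} (h : Comp B C) {b c : S} (hb : b ∈ B.carrier)
    (hc : c ∈ C.carrier) : b * c ∈ (ArrowGroupoid.mul B C).carrier :=
  Germ.mul_mem (comp_iff.1 h) hb hc

theorem mul_src_mem {C : T.Coset} {c d : S} (hc : c ∈ C.carrier) (hd : d ∈ (src C).carrier) :
    c * d ∈ C.carrier := by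
  have := mul_mem_of_comp (B := C) (C := src C) (rng_src C).symm hc hd
  rwa [mul_src] at this

theorem rng_mul_mem {C : T.Coset} {c d : S} (hd : d ∈ (rng C).carrier) (hc : c ∈ C.carrier) :
    d * c ∈ C.carrier := by
  have := mul_mem_of_comp (B := rng C) (C := C) (src_rng C) hd hc
  rwa [rng_mul_self] at this

/-- A coset is determined by any of its elements and its source. -/
theorem le_of_src_eq {B C : T.Coset} {a : S} (hB : a ∈ B.carrier) (hC : a ∈ C.carrier)
    (h : src B = src C) : B.carrier ⊆ C.carrier := by
  intro b hb
  obtain ⟨a0, ha0, s, hs, k⟩ := B.isCoset.exists_dom hB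
  obtain ⟨b0, hb0, l⟩ := B.round hb
  -- The bracketing `a(sb₀)` shows membership in `C`, as `sb₀` lies in the common source; the
  -- bracketing `(as)b₀` with `as ∈ Z` shows that it is below `b`.
  refine C.isCoset.up_mem (a := a * (s * b0)) (mul_src_mem hC ?_) ?_
  · rw [← h]; exact star_mul_mem_src hs hb0
  · rw [← mul_assoc]; exact l.n_mul (T.Z_le_N k.bs_mem)

theorem le_of_rng_eq {B C : T.Coset} {a : S} (hB : a ∈ B.carrier) (hC : a ∈ C.carrier)
    (h : rng B = rng C) : B.carrier ⊆ C.carrier := by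
  intro b hb
  obtain ⟨a0, ha0, s, hs, k⟩ := B.isCoset.exists_dom hB
  obtain ⟨b0, hb0, l⟩ := B.round hb
  refine C.isCoset.up_mem (a := b0 * s * a) (rng_mul_mem ?_ hC) ?_
  · rw [← h]; exact mul_star_mem_rng hb0 hs
  · rw [mul_assoc]; exact l.mul_n (T.Z_le_N k.sb_mem)

theorem eq_of_src_eq {B C : T.Coset} {a : S} (hB : a ∈ B.carrier) (hC : a ∈ C.carrier)
    (h : src B = src C) : B = C :=
  ext ((le_of_src_eq hB hC h).antisymm (le_of_src_eq hC hB h.symm))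

theorem eq_of_rng_eq {B C : T.Coset} {a : S} (hB : a ∈ B.carrier) (hC : a ∈ C.carrier)
    (h : rng B = rng C) : B = C :=
  ext ((le_of_rng_eq hB hC h).antisymm (le_of_rng_eq hC hB h.symm))

theorem isSlice_cosetsAt (a : S) : IsSlice (T.cosetsAt a) :=
  ⟨fun _ hB _ hC h => eq_of_src_eq hB hC h, fun _ hB _ hC h => eq_of_rng_eq hB hC h⟩

theorem star_eq_of_mem_units {C : T.Coset} (h : C ∈ units T.Coset) :
    T.star C.carrier = C.carrier := by
  have h1 : C = ArrowGroupoid.inv C := eq_inv_of_mul_mem_units h.1 (by rw [h.2]; exact h)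
  exact congrArg carrier h1.symm

/-- Cosets meeting `N` are units. -/
theorem mem_units_of_mem_N {C : T.Coset} {n : S} (hn : n ∈ T.N) (hC : n ∈ C.carrier) :
    C ∈ units T.Coset := by
  have h1 : (src C).carrier ⊆ C.carrier := by
    intro d hd
    obtain ⟨d0, hd0, k⟩ := (src C).round hd
    exact C.isCoset.up_mem (mul_src_mem hC hd0) (k.n_mul hn)
  have h2 : C.carrier ⊆ (src C).carrier := by
    intro c hc
    obtain ⟨c0, hc0, k⟩ := C.round hc
    obtain ⟨a, _, s, hs, l⟩ := C.isCoset.exists_dom hC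
    have hd : s * n ∈ (src C).carrier := star_mul_mem_src hs hC
    -- The source is a unit, hence equal to its own dual, and it lies in `C` by the first inclusion;
    -- so `sn` also lies in `C^*`. Then `(sn)c₀` lies in the source and is below `c`, since `sn ∈
    -- Z`.
    have hd' : s * n ∈ T.star C.carrier := by
      rw [← star_eq_of_mem_units (src_mem_units C)] at hd
      exact star_mono h1 hd
    exact (src C).isCoset.up_mem (star_mul_mem_src hd' hc0) (k.n_mul (T.Z_le_N l.sb_mem))
  rw [ext (h2.antisymm h1)]
  exact src_mem_units C

/-! ### Translates `(aD)^<` of a coset `D`. -/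

section Translate

variable {D : T.Coset} {a0 s a : S}

/-- From `a₀ <ₛ a` one gets `sa₀s <ₐ s`, so `a` is itself in the dual of `{sa₀s}`. Hence `(aD)^*a ⊆
(sa₀saD)^* = (sa₀D)^* ⊆ D^*`, the last step because `sa₀ ∈ r(D)`. -/
theorem star_smul_mul_subset (h : T.DomVia a0 s a)
    (hD : s * a0 ∈ (rng D).carrier) : T.star ({a} * D.carrier) * {a} ⊆ T.star D.carrier := by
  have h2 : ({a} : Set S) ⊆ T.star {s * a0 * s} := by
    rintro _ rfl
    exact ⟨_, rfl, s, switch_left h.sa_mem h⟩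
  refine (Set.mul_subset_mul_left h2).trans ((star_mul_star _ _).trans (star_mono ?_))
  rw [Set.singleton_mul, Set.singleton_mul, Set.image_image]
  rintro _ ⟨d, hd, rfl⟩
  have : s * a0 * s * (a * d) = s * a0 * d := by
    calc s * a0 * s * (a * d) = s * (a0 * s * a) * d := by simp only [mul_assoc]
      _ = _ := by rw [h.left]
  simp only [this]
  exact rng_mul_mem hD hd

theorem isAtlas_smul (h : T.DomVia a0 s a) (hD : s * a0 ∈ (rng D).carrier) :
    T.IsAtlas ({a} * D.carrier) := by
  constructor
  · calc {a} * D.carrier * T.star ({a} * D.carrier) * ({a} * D.carrier)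
        = {a} * D.carrier * (T.star ({a} * D.carrier) * {a}) * D.carrier := by
          simp only [mul_assoc]
      _ ⊆ {a} * D.carrier * T.star D.carrier * D.carrier :=
          Set.mul_subset_mul_right (Set.mul_subset_mul_left (star_smul_mul_subset h hD))
      _ = {a} * (D.carrier * T.star D.carrier * D.carrier) := by simp only [mul_assoc]
      _ ⊆ _ := Set.mul_subset_mul_left D.isCoset.triple
  · intro x hx
    rw [Set.singleton_mul] at hx
    obtain ⟨d, hd, rfl⟩ := hx
    obtain ⟨d1, hd1, k⟩ := D.round hd
    -- This element of `aD` is just `a₀d₁`, which is below `ad` factor by factor.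
    refine ⟨a * (s * a0 * d1), Set.mul_mem_mul rfl (rng_mul_mem hD hd1), ?_⟩
    have : a * (s * a0 * d1) = a0 * d1 := by
      simp only [← mul_assoc]; rw [h.right]
    rw [this]
    exact Dom.mul ⟨s, h⟩ k

/-- The coset `(aD)^<`, for `a₀ <ₛ a` with `sa₀ ∈ r(D)`. -/
def smul (h : T.DomVia a0 s a) (hD : s * a0 ∈ (rng D).carrier) : T.Coset :=
  ⟨T.up ({a} * D.carrier), (isAtlas_smul h hD).up,
    ((Set.singleton_nonempty a).mul D.nonempty).mono (isAtlas_smul h hD).round⟩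

theorem smul_carrier (h : T.DomVia a0 s a) (hD : s * a0 ∈ (rng D).carrier) :
    (smul h hD).carrier = T.up ({a} * D.carrier) := rfl

theorem mul_mem_smul (h : T.DomVia a0 s a) (hD : s * a0 ∈ (rng D).carrier) {d : S}
    (hd : d ∈ D.carrier) : a * d ∈ (smul h hD).carrier :=
  (isAtlas_smul h hD).round (Set.mul_mem_mul rfl hd)

theorem mem_star_smul (h : T.DomVia a0 s a) (hD : s * a0 ∈ (rng D).carrier)
    (hu : D ∈ units T.Coset) : s ∈ T.star (smul h hD).carrier := by
  refine ⟨a0, ?_, a, h⟩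
  have := mul_mem_smul h hD (d := s * a0) (by rwa [rng_of_mem_units hu] at hD)
  rwa [← mul_assoc, h.right] at this

theorem mem_smul (h : T.DomVia a0 s a) (hD : s * a0 ∈ (rng D).carrier)
    (hu : D ∈ units T.Coset) : a ∈ (smul h hD).carrier := by
  refine (smul h hD).isCoset.up_mem (a := a0) ?_ ⟨s, h⟩
  have := mul_mem_smul h hD (d := s * a0) (by rwa [rng_of_mem_units hu] at hD)
  rwa [← mul_assoc, h.right] at this

/-- One inclusion is `(aD)^*aD ⊆ D^*D`. For the other, `s` lies in the dual of the translate and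
`ad₁` in the translate, so `(sa)d₁` is in the source, and it is below `d` when `d₁ < d` because `sa
∈ Z`. -/
theorem src_smul (h : T.DomVia a0 s a) (hD : s * a0 ∈ (rng D).carrier)
    (hu : D ∈ units T.Coset) : src (smul h hD) = D := by
  apply ext
  apply Set.Subset.antisymm
  · rw [src_carrier, smul_carrier, (isAtlas_smul h hD).star_up,
      up_mul_up' (isAtlas_smul h hD).star.atlas.round (isAtlas_smul h hD).round, ← mul_assoc]
    have e : T.up (T.star D.carrier * D.carrier) = D.carrier := by
      rw [← src_carrier, src_of_mem_units hu]
    conv_rhs => rw [← e]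
    exact up_mono (Set.mul_subset_mul_right (star_smul_mul_subset h hD))
  · intro d hd
    obtain ⟨d1, hd1, k⟩ := D.round hd
    have := star_mul_mem_src (mem_star_smul h hD hu) (mul_mem_smul h hD hd1)
    refine IsCoset.up_mem (Coset.isCoset _) this ?_
    rw [← mul_assoc]
    exact k.n_mul (T.Z_le_N h.sb_mem)

end Translate

/-! ### The étale topology of the coset groupoid. -/

theorem isOpen_cosetsAt (a : S) : IsOpen (T.cosetsAt a) :=
  TopologicalSpace.isOpen_generateFrom_of_mem ⟨a, rfl⟩

/-- Working form of the generated topology: finite intersections of the sets `cosetsAt a` form a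
base, so being near `C` means containing a prescribed finite part of `C`. -/
theorem isOpen_iff {O : Set T.Coset} : IsOpen O ↔ ∀ C ∈ O, ∃ F : Set S, F.Finite ∧
    F ⊆ C.carrier ∧ ∀ C' : T.Coset, F ⊆ C'.carrier → C' ∈ O := by
  constructor
  · intro h
    induction h with
    | basic U hU =>
      obtain ⟨a, rfl⟩ := hU
      intro C hC
      exact ⟨{a}, Set.finite_singleton a, Set.singleton_subset_iff.2 hC,
        fun C' h => h rfl⟩
    | univ => exact fun C _ => ⟨∅, Set.finite_empty, Set.empty_subset _, fun _ _ => trivial⟩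
    | inter U V _ _ hU hV =>
      rintro C ⟨h1, h2⟩
      obtain ⟨F, f1, f2, f3⟩ := hU C h1
      obtain ⟨E, e1, e2, e3⟩ := hV C h2
      exact ⟨F ∪ E, f1.union e1, Set.union_subset f2 e2, fun C' h =>
        ⟨f3 C' (Set.subset_union_left.trans h), e3 C' (Set.subset_union_right.trans h)⟩⟩
    | sUnion A _ hA =>
      rintro C ⟨U, hU, hC⟩
      obtain ⟨F, f1, f2, f3⟩ := hA U hU C hC
      exact ⟨F, f1, f2, fun C' h => ⟨U, hU, f3 C' h⟩⟩
  · intro h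
    rw [isOpen_iff_forall_mem_open]
    intro C hC
    obtain ⟨F, f1, f2, f3⟩ := h C hC
    refine ⟨⋂ a ∈ F, T.cosetsAt a, fun C' h' => f3 C' fun a ha => ?_,
      f1.isOpen_biInter fun a _ => isOpen_cosetsAt a, ?_⟩
    · exact Set.mem_iInter₂.1 h' a ha
    · exact Set.mem_iInter₂.2 fun a ha => f2 ha

/-- Membership in `C^*` is witnessed by one element of `C`, and membership in `B · C` by one element
of each factor; these witnesses remain valid in all cosets containing them. -/
theorem isTopGroupoid : IsTopGroupoid T.Coset := by
  constructor
  · refine continuous_generateFrom_iff.2 ?_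
    rintro _ ⟨a, rfl⟩
    refine isOpen_iff.2 ?_
    rintro C ⟨d, hd, b, h⟩
    exact ⟨{d}, Set.finite_singleton d, by simpa using hd, fun C' h' =>
      ⟨d, by simpa using h', b, h⟩⟩
  · refine continuous_generateFrom_iff.2 ?_
    rintro _ ⟨a, rfl⟩
    rw [isOpen_iff_forall_mem_open]
    rintro ⟨⟨B, C⟩, hBC⟩ h
    replace h : a ∈ (Coset.mul B C).carrier := h
    rw [mul_carrier (comp_iff.1 hBC)] at h
    obtain ⟨_, ⟨b, hb, c, hc, rfl⟩, k⟩ := h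
    refine ⟨Subtype.val ⁻¹' (T.cosetsAt b ×ˢ T.cosetsAt c), ?_,
      ((isOpen_cosetsAt b).prod (isOpen_cosetsAt c)).preimage continuous_subtype_val, hb, hc⟩
    rintro ⟨⟨B', C'⟩, hBC'⟩ ⟨h1, h2⟩
    exact IsCoset.up_mem (Coset.isCoset _) (mul_mem_of_comp hBC' h1 h2) k

theorem isEtaleGroupoid : IsEtaleGroupoid T.Coset := by
  refine ⟨isTopGroupoid, fun O hO => isOpen_iff.2 ?_⟩
  rintro _ ⟨C, hC, rfl⟩
  obtain ⟨F, f1, f2, f3⟩ := isOpen_iff.1 hO C hC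
  obtain ⟨a, ha⟩ := C.nonempty
  obtain ⟨a0, ha0, s, hs, h⟩ := C.isCoset.exists_dom ha
  have hr : ∀ c ∈ F, ∃ c0 ∈ C.carrier, T.Dom c0 c := fun c hc => C.round (f2 hc)
  choose! r r1 r2 using hr
  -- Let `D` contain this finite set. Then `sa ∈ Z` forces `D` to be a unit, `sa₀` makes the
  -- translate `(aD)^<` available, and `s r(c)` puts `(as)r(c)`, hence also `c`, into that
  -- translate. So the translate lies in `O` and has source `D`.
  refine ⟨{s * a, s * a0} ∪ (fun c => s * r c) '' F, ?_, ?_, ?_⟩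
  · exact (Set.toFinite _).union (f1.image _)
  · rintro x ((rfl | rfl) | ⟨c, hc, rfl⟩)
    · exact star_mul_mem_src hs ha
    · exact star_mul_mem_src hs ha0
    · exact star_mul_mem_src hs (r1 c hc)
  · intro D hD
    have hu : D ∈ units T.Coset :=
      mem_units_of_mem_N (T.Z_le_N h.sb_mem) (hD (Or.inl (Or.inl rfl)))
    have h0 : s * a0 ∈ (rng D).carrier := by
      rw [rng_of_mem_units hu]; exact hD (Or.inl (Or.inr rfl))
    refine ⟨smul h h0, f3 _ fun c hc => ?_, src_smul h h0 hu⟩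
    have := mul_mem_smul h h0 (hD (Or.inr ⟨c, hc, rfl⟩))
    refine (smul h h0).isCoset.up_mem this ?_
    rw [← mul_assoc]
    exact (r2 c hc).n_mul (T.Z_le_N h.bs_mem)

/-- If `Z` is symmetric then `𝒞_{ab} ⊆ 𝒞_a 𝒞_b`. -/
theorem exists_factor (hZ : T.IsSymmetric) {C : T.Coset} {a b : S}
    (h : a * b ∈ C.carrier) : ∃ A B : T.Coset, a ∈ A.carrier ∧ b ∈ B.carrier ∧ Comp A B ∧
      C = ArrowGroupoid.mul A B := by
  obtain ⟨c, hc, t, ht, k⟩ := C.isCoset.exists_dom h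
  -- Passing from `t` to `t(ab)t` keeps `ab` dominating `c`, and it turns `bsa` into `(bt)a(bt)a`,
  -- which is in `Z` by symmetry applied to `a(bt) ∈ Z`.
  obtain ⟨s, hs⟩ : ∃ s, s = t * (a * b) * t := ⟨_, rfl⟩
  have e1 : c * s = c * t := by
    rw [hs, ← mul_assoc, ← mul_assoc, k.left]
  have hsC : s ∈ T.star C.carrier := by rw [hs]; exact C.isCoset.mul3' ht h ht
  have l : T.DomVia c s (a * b) := by
    refine domVia_of_left (by rw [e1, k.left]) (by rw [e1]; exact k.as_mem) ?_ ?_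
    · have := T.Z.mul_mem k.bs_mem k.bs_mem
      rw [hs]; simpa only [mul_assoc] using this
    · have := T.Z.mul_mem k.sb_mem k.sb_mem
      rw [hs]; simpa only [mul_assoc] using this
  have hbsa : b * s * a ∈ T.Z := by
    have := hZ a (b * t) (by have := k.bs_mem; rwa [mul_assoc] at this)
    rw [hs]; simpa only [mul_assoc] using this
  have habs : a * (b * s) ∈ T.Z := by rw [← mul_assoc]; exact l.bs_mem
  -- With `sa` as local inverse of `b`, and `(sa)(bsc) = sc` in the source of `C`, the translate of
  -- that source by `b` is defined. It is the right factor `B`.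
  have hb : T.DomVia (b * (s * c)) (s * a) b := by
    have e : s * a * (b * (s * c)) = s * c := by
      calc s * a * (b * (s * c)) = s * (a * b * s * c) := by simp only [mul_assoc]
        _ = _ := by rw [l.right]
    refine domVia_of_right ?_ ?_ ?_ ?_
    · rw [mul_assoc, e]
    · rw [e]; exact l.sa_mem
    · rw [← mul_assoc]; exact hbsa
    · rw [mul_assoc]; exact l.sb_mem
  have e : s * a * (b * (s * c)) = s * c := by
    calc s * a * (b * (s * c)) = s * (a * b * s * c) := by simp only [mul_assoc]
      _ = _ := by rw [l.right]
  have hu := src_mem_units C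
  have hD : s * a * (b * (s * c)) ∈ (rng (src C)).carrier := by
    rw [e, rng_src]; exact star_mul_mem_src hsC hc
  have hBs := src_smul hb hD hu
  have hcomp : Comp C (ArrowGroupoid.inv (smul hb hD)) := by
    unfold Comp; rw [rng_inv, hBs]
  -- The left factor must be `C · B⁻¹`. It contains `csa`, which `a` dominates via `bs`.
  refine ⟨ArrowGroupoid.mul C (ArrowGroupoid.inv (smul hb hD)), smul hb hD, ?_,
    mem_smul hb hD hu, ?_, ?_⟩
  · refine IsCoset.up_mem (Coset.isCoset _)
      (mul_mem_of_comp hcomp hc (mem_star_smul hb hD hu)) ⟨b * s, ?_⟩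
    have e2 : c * (s * a) * (b * s) = c * s := by
      calc c * (s * a) * (b * s) = c * s * (a * b) * s := by simp only [mul_assoc]
        _ = _ := by rw [l.left]
    refine domVia_of_left ?_ ?_ habs hbsa
    · rw [e2, mul_assoc]
    · rw [e2]; exact l.as_mem
  · unfold Comp; rw [ArrowGroupoid.src_mul hcomp, src_inv]
  · have := ArrowGroupoid.mul_mul_inv C (ArrowGroupoid.inv (smul hb hD)) hcomp
    rw [ArrowGroupoid.inv_inv] at this
    exact this.symm

end Coset

/-! ### The topological groupoid of germs and its projection. -/

namespace Germ

theorem comp_iff_comp_coset {x y : T.Germ} : Comp x y ↔ Comp x.coset y.coset :=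
  comp_iff.trans Coset.comp_iff.symm

theorem mk_mul_mk_of_comp {A B : T.Coset} (h : Comp A B) {a b : S} (ha : a ∈ A.carrier)
    (hb : b ∈ B.carrier) : ArrowGroupoid.mul (mk' a A ha) (mk' b B hb) =
      mk' (a * b) (ArrowGroupoid.mul A B) (Coset.mul_mem_of_comp h ha hb) :=
  mk_mul_mk (Coset.comp_iff.1 h) ha hb

theorem isOpen_setOf_mk (s : S) :
    IsOpen {x : T.Germ | ∃ C, ∃ hs : s ∈ C.carrier, x = mk' s C hs} :=
  TopologicalSpace.isOpen_generateFrom_of_mem (Or.inl ⟨s, rfl⟩)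

theorem isOpen_setOf_mem (s : S) : IsOpen {x : T.Germ | s ∈ x.coset.carrier} :=
  TopologicalSpace.isOpen_generateFrom_of_mem (Or.inr ⟨s, rfl⟩)

/-- Equality of germs is an open condition: it comes from one relation `au = bu` with `u ∈ C^*`, and
`u` stays in the dual of every coset containing a single `d ∈ C`. -/
theorem exists_finite_equivalent {C : T.Coset} {a b : S} (ha : a ∈ C.carrier)
    (hb : b ∈ C.carrier) (h : T.Equivalent C.carrier a b) :
    ∃ F : Set S, F.Finite ∧ F ⊆ C.carrier ∧ ∀ C' : T.Coset, F ⊆ C'.carrier →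
      T.Equivalent C'.carrier a b := by
  obtain ⟨u, ⟨d, hd, e, k⟩, l⟩ := Equivalent.exists_right ha hb h
  refine ⟨{d}, Set.finite_singleton d, Set.singleton_subset_iff.2 hd, fun C' h' => ?_⟩
  exact equivalent_of ⟨d, h' rfl, e, k⟩ l

/-- Neighbourhoods of `[c, C]` can be described with the representative `c` held fixed and only the
coset varying. The generators `{[s, C']}` fit this pattern by `exists_finite_equivalent`, which
passes from `s` to `c`. -/
theorem isOpen_iff {O : Set T.Germ} : IsOpen O ↔
    ∀ (c : S) (C : T.Coset) (hc : c ∈ C.carrier), mk' c C hc ∈ O → ∃ F : Set S, F.Finite ∧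
      F ⊆ C.carrier ∧ ∀ (C' : T.Coset) (hc' : c ∈ C'.carrier), F ⊆ C'.carrier →
        mk' c C' hc' ∈ O := by
  constructor
  · intro h
    induction h with
    | basic U hU =>
      rintro c C hc hx
      obtain ⟨s, rfl⟩ | ⟨s, rfl⟩ := hU
      · obtain ⟨D, hs, e⟩ := hx
        obtain rfl : C = D := congrArg Germ.coset e
        obtain ⟨F, f1, f2, f3⟩ := exists_finite_equivalent hc hs ((mk_eq_mk hc hs).1 e)
        refine ⟨insert s F, f1.insert s, Set.insert_subset hs f2, fun C' hc' h => ?_⟩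
        have h' := Set.insert_subset_iff.1 h
        exact ⟨C', h'.1, (mk_eq_mk hc' h'.1).2 (f3 C' h'.2)⟩
      · exact ⟨{s}, Set.finite_singleton s, Set.singleton_subset_iff.2 hx,
          fun C' _ h => h rfl⟩
    | univ => exact fun _ _ _ _ =>
        ⟨∅, Set.finite_empty, Set.empty_subset _, fun _ _ _ => trivial⟩
    | inter U V _ _ hU hV =>
      rintro c C hc ⟨h1, h2⟩
      obtain ⟨F, f1, f2, f3⟩ := hU c C hc h1
      obtain ⟨E, e1, e2, e3⟩ := hV c C hc h2
      exact ⟨F ∪ E, f1.union e1, Set.union_subset f2 e2, fun C' hc' h =>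
        ⟨f3 C' hc' (Set.subset_union_left.trans h), e3 C' hc' (Set.subset_union_right.trans h)⟩⟩
    | sUnion A _ hA =>
      rintro c C hc ⟨U, hU, hC⟩
      obtain ⟨F, f1, f2, f3⟩ := hA U hU c C hc hC
      exact ⟨F, f1, f2, fun C' hc' h => ⟨U, hU, f3 C' hc' h⟩⟩
  · intro h
    rw [isOpen_iff_forall_mem_open]
    intro x hx
    obtain ⟨c, C, hc, -, -, -, -, rfl⟩ := x.exists_mk
    obtain ⟨F, f1, f2, f3⟩ := h c C hc hx
    refine ⟨{x | ∃ C, ∃ hs : c ∈ C.carrier, x = mk' c C hs} ∩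
      ⋂ a ∈ F, {x : T.Germ | a ∈ x.coset.carrier}, ?_,
      (isOpen_setOf_mk c).inter (f1.isOpen_biInter fun a _ => isOpen_setOf_mem a),
      ⟨C, hc, rfl⟩, ?_⟩
    · rintro _ ⟨⟨D, hD, rfl⟩, h'⟩
      exact f3 D hD fun a ha => Set.mem_iInter₂.1 h' a ha
    · exact Set.mem_iInter₂.2 fun a ha => f2 ha

theorem continuous_coset : Continuous (coset : T.Germ → T.Coset) := by
  refine continuous_generateFrom_iff.2 ?_
  rintro _ ⟨a, rfl⟩
  exact isOpen_setOf_mem a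

theorem isOpenMap_coset : IsOpenMap (coset : T.Germ → T.Coset) := by
  refine fun O hO => Coset.isOpen_iff.2 ?_
  rintro _ ⟨x, hx, rfl⟩
  obtain ⟨c, C, hc, -, -, -, -, rfl⟩ := x.exists_mk
  obtain ⟨F, f1, f2, f3⟩ := isOpen_iff.1 hO c C hc hx
  refine ⟨insert c F, f1.insert c, Set.insert_subset hc f2, fun C' h => ?_⟩
  have h' := Set.insert_subset_iff.1 h
  exact ⟨mk' c C' h'.1, f3 C' h'.1 h'.2, rfl⟩

theorem inv_mk_eq {C : T.Coset} {d s c : S} (hd : d ∈ C.carrier) (h : T.DomVia d s c)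
    (hc : c ∈ C.carrier) : ArrowGroupoid.inv (mk' c C hc) =
      mk' s (ArrowGroupoid.inv C) (mem_inv hd h) := inv_mk hd h hc

/-- Representatives can be kept constant nearby: if `d <ₛ c`, then `s` represents the inverse of
`[c, C']` for every `C'` containing `c` and `d`, and `ab` always represents a product of germs of
`a` and `b`. What remains is the finite-witness argument for cosets. -/
theorem isTopGroupoid : IsTopGroupoid T.Germ := by
  constructor
  · rw [continuous_def]
    intro O hO
    refine isOpen_iff.2 fun c C hc hx => ?_
    obtain ⟨d, hd, s, hs, k⟩ := C.isCoset.exists_dom hc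
    rw [Set.mem_preimage, inv_mk_eq hd k] at hx
    obtain ⟨F, f1, f2, f3⟩ := isOpen_iff.1 hO s _ _ hx
    have hr : ∀ t ∈ F, ∃ e ∈ C.carrier, ∃ b, T.DomVia e t b := fun t ht => f2 ht
    choose! r r1 b r2 using hr
    refine ⟨insert d (r '' F), (f1.image _).insert d, ?_, fun C' hc' h => ?_⟩
    · refine Set.insert_subset hd ?_
      rintro _ ⟨t, ht, rfl⟩
      exact r1 t ht
    · have h' := Set.insert_subset_iff.1 h
      rw [Set.mem_preimage, inv_mk_eq h'.1 k]
      exact f3 _ _ fun t ht => ⟨r t, h'.2 ⟨t, ht, rfl⟩, b t, r2 t ht⟩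
  · rw [continuous_def]
    intro O hO
    rw [isOpen_iff_forall_mem_open]
    rintro ⟨⟨x, y⟩, hxy⟩ h
    obtain ⟨a, A, ha, -, -, -, -, rfl⟩ := x.exists_mk
    obtain ⟨b, B, hb, -, -, -, -, rfl⟩ := y.exists_mk
    have hAB : Comp A B := comp_iff_comp_coset.1 hxy
    replace h : ArrowGroupoid.mul (mk' a A ha) (mk' b B hb) ∈ O := h
    rw [mk_mul_mk_of_comp hAB] at h
    obtain ⟨F, f1, f2, f3⟩ := isOpen_iff.1 hO _ _ _ h
    have hr : ∀ t ∈ F, ∃ p q, p ∈ A.carrier ∧ q ∈ B.carrier ∧ T.Dom (p * q) t := by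
      intro t ht
      have := f2 ht
      change t ∈ (Coset.mul A B).carrier at this
      rw [Coset.mul_carrier (Coset.comp_iff.1 hAB)] at this
      obtain ⟨_, ⟨p, hp, q, hq, rfl⟩, k⟩ := this
      exact ⟨p, q, hp, hq, k⟩
    choose! p q hp hq hpq using hr
    refine ⟨Subtype.val ⁻¹' (({x | ∃ C, ∃ hs : a ∈ C.carrier, x = mk' a C hs} ∩
        ⋂ t ∈ F, {x : T.Germ | p t ∈ x.coset.carrier}) ×ˢ
      ({x | ∃ C, ∃ hs : b ∈ C.carrier, x = mk' b C hs} ∩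
        ⋂ t ∈ F, {x : T.Germ | q t ∈ x.coset.carrier})), ?_, ?_,
      ⟨⟨A, ha, rfl⟩, Set.mem_iInter₂.2 hp⟩, ⟨B, hb, rfl⟩, Set.mem_iInter₂.2 hq⟩
    · rintro ⟨⟨_, _⟩, hxy'⟩ ⟨⟨⟨A', ha', rfl⟩, h1⟩, ⟨B', hb', rfl⟩, h2⟩
      have hAB' : Comp A' B' := comp_iff_comp_coset.1 hxy'
      change ArrowGroupoid.mul (mk' a A' ha') (mk' b B' hb') ∈ O
      rw [mk_mul_mk_of_comp hAB']
      exact f3 _ _ fun t ht => IsCoset.up_mem (Coset.isCoset _)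
        (Coset.mul_mem_of_comp hAB' (Set.mem_iInter₂.1 h1 t ht) (Set.mem_iInter₂.1 h2 t ht))
        (hpq t ht)
    · refine (IsOpen.prod ?_ ?_).preimage continuous_subtype_val
      · exact (isOpen_setOf_mk a).inter (f1.isOpen_biInter fun t _ => isOpen_setOf_mem _)
      · exact (isOpen_setOf_mk b).inter (f1.isOpen_biInter fun t _ => isOpen_setOf_mem _)

/-- Composability of germs depends only on their cosets. So two units over one coset are composable,
and each then equals the common source and range. -/
theorem isIsocofibration_coset : IsIsocofibration (coset : T.Germ → T.Coset) := by
  refine ⟨fun x y h => ⟨comp_iff_comp_coset.1 h, mul_coset (comp_iff.1 h)⟩, ?_⟩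
  intro x hx y hy h
  have : Comp x y := by
    rw [comp_iff_comp_coset, ← h]
    exact comp_iff_comp_coset.1 hx.1
  rw [← src_of_mem_units hx, ← rng_of_mem_units hy]
  exact this

theorem mk_mem_tildeSection {a : S} {C : T.Coset} (ha : a ∈ C.carrier) :
    (mk' a C ha, C) ∈ T.tildeSection a := ⟨C, ha, rfl⟩

end Germ

/-! ### The canonical bundle representation on the coset bundle. -/

variable (T)

theorem isGroupoidBundle_cosetBundle : IsGroupoidBundle T.cosetBundle :=
  ⟨Germ.isTopGroupoid, Coset.isEtaleGroupoid, Germ.isIsocofibration_coset,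
    Germ.continuous_coset, Germ.isOpenMap_coset⟩

theorem dom_tildeSection (a : S) : BinRel.dom (T.tildeSection a) = T.cosetsAt a := by
  ext C
  constructor
  · rintro ⟨_, -, D, hD, e⟩
    obtain ⟨-, rfl⟩ := Prod.mk.inj e
    exact hD
  · intro h
    exact ⟨_, trivial, Germ.mk_mem_tildeSection h⟩

theorem isSliceSection_tildeSection (a : S) :
    IsSliceSection T.cosetBundle (T.tildeSection a) where
  isFunction := by
    rintro _ _ _ ⟨C, hC, e⟩ ⟨D, hD, e'⟩
    obtain ⟨rfl, rfl⟩ := Prod.mk.inj e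
    obtain ⟨rfl, rfl⟩ := Prod.mk.inj e'
    rfl
  isContinuous := by
    refine fun O hO => Coset.isOpen_iff.2 ?_
    rintro _ ⟨_, hO', C, hC, e⟩
    obtain ⟨rfl, rfl⟩ := Prod.mk.inj e
    obtain ⟨F, f1, f2, f3⟩ := Germ.isOpen_iff.1 hO a _ hC hO'
    refine ⟨insert a F, f1.insert a, Set.insert_subset hC f2, fun C' h => ?_⟩
    have h' := Set.insert_subset_iff.1 h
    exact ⟨_, f3 C' h'.1 h'.2, Germ.mk_mem_tildeSection h'.1⟩
  isOpen_dom := by rw [dom_tildeSection]; exact Coset.isOpen_cosetsAt a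
  isSlice_dom := by rw [dom_tildeSection]; exact Coset.isSlice_cosetsAt a
  proj := by
    rintro _ _ ⟨C, hC, e⟩
    obtain ⟨rfl, rfl⟩ := Prod.mk.inj e
    rfl

variable {T}

/-- Germs multiply through representatives, so only the domains are at stake; the nontrivial
inclusion is the factorisation `Coset.exists_factor`. -/
theorem tildeSection_mul (hZ : T.IsSymmetric) (a b : S) :
    T.tildeSection (a * b) = sectionMul (T.tildeSection a) (T.tildeSection b) := by
  ext p
  constructor
  · rintro ⟨C, hC, rfl⟩
    obtain ⟨A, B, hA, hB, h, rfl⟩ := Coset.exists_factor hZ hC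
    exact ⟨_, A, _, B, Germ.mk_mem_tildeSection hA, Germ.mk_mem_tildeSection hB, h,
      by rw [Germ.mk_mul_mk_of_comp h]⟩
  · rintro ⟨_, _, _, _, ⟨A, hA, e⟩, ⟨B, hB, e'⟩, h, rfl⟩
    obtain ⟨rfl, rfl⟩ := Prod.mk.inj e
    obtain ⟨rfl, rfl⟩ := Prod.mk.inj e'
    rw [Germ.mk_mul_mk_of_comp h]
    exact Germ.mk_mem_tildeSection _

theorem cosetsAt_mul (hZ : T.IsSymmetric) (a b : S) :
    T.cosetsAt (a * b) = setMul (T.cosetsAt a) (T.cosetsAt b) := by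
  ext C
  constructor
  · intro hC
    obtain ⟨A, B, hA, hB, h, rfl⟩ := Coset.exists_factor hZ hC
    exact ⟨A, hA, B, hB, h, rfl⟩
  · rintro ⟨A, hA, B, hB, h, rfl⟩
    exact Coset.mul_mem_of_comp h hA hB

theorem isEtaleRep_cosetsAt (hZ : T.IsSymmetric) : T.IsEtaleRep T.cosetsAt where
  etale := Coset.isEtaleGroupoid
  isOpen := Coset.isOpen_cosetsAt
  isSlice := Coset.isSlice_cosetsAt
  map_mul := cosetsAt_mul hZ
  cover C := C.nonempty
  map_N _ hn _ hC := Coset.mem_units_of_mem_N hn hC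
  locally_round C a ha := by
    obtain ⟨b, hb, h⟩ := C.round ha
    exact ⟨b, h, hb⟩

theorem isBundleRep_tildeSection (hZ : T.IsSymmetric) :
    T.IsBundleRep T.cosetBundle T.tildeSection where
  bundle := T.isGroupoidBundle_cosetBundle
  isSliceSection := T.isSliceSection_tildeSection
  map_mul := tildeSection_mul hZ
  etaleRep := by
    simp only [dom_tildeSection]
    exact isEtaleRep_cosetsAt hZ

/-- The elements of `S` whose image contains `g`. -/
def elemsAt {G : Type*} (θ : S → Set G) (g : G) : Set S := {a | g ∈ θ a}

/-! ### Étale representations: the coset at an arrow. -/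

namespace IsEtaleRep

variable {G : Type*} [ArrowGroupoid G] [TopologicalSpace G] {θ : S → Set G}

theorem mul_mem (hθ : T.IsEtaleRep θ) {a b : S} {g h : G} (ha : g ∈ θ a) (hb : h ∈ θ b)
    (k : Comp g h) : ArrowGroupoid.mul g h ∈ θ (a * b) := by
  rw [hθ.map_mul]; exact ⟨g, ha, h, hb, k, rfl⟩

/-- Elements of `N` are represented by sets of units, so multiplying by one of them can only shrink
a slice. With `a = (as)b` this makes `θ` monotone for domination. -/
theorem mem_of_mem_mul_left (hθ : T.IsEtaleRep θ) {n b : S} {g : G} (hn : n ∈ T.N)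
    (h : g ∈ θ (n * b)) : g ∈ θ b := by
  rw [hθ.map_mul] at h
  obtain ⟨k, hk, l, hl, c, rfl⟩ := h
  rwa [unit_mul (hθ.map_N n hn hk) c]

theorem mem_of_dom (hθ : T.IsEtaleRep θ) {a b : S} {g : G} (h : T.Dom a b) (ha : g ∈ θ a) :
    g ∈ θ b := by
  obtain ⟨s, h⟩ := h
  rw [← h.left] at ha
  exact hθ.mem_of_mem_mul_left h.as_mem ha

/-- Since `a = (as)b`, the arrow `g` is a unit of `θ(as)` times an arrow of `θ(b)`. That unit
factors as `pq` with `p ∈ θ(a)` and `q ∈ θ(s)`, so `q = p⁻¹`; and `p = g` because both lie in the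
slice `θ(a)` and have the same range. -/
theorem inv_mem_of_domVia (hθ : T.IsEtaleRep θ) {a s b : S} {g : G} (h : T.DomVia a s b)
    (ha : g ∈ θ a) : inv g ∈ θ s := by
  have ha' := ha
  rw [← h.left, hθ.map_mul] at ha
  obtain ⟨k, hk, l, hl, c, e⟩ := ha
  have hku := hθ.map_N _ h.as_mem hk
  rw [hθ.map_mul] at hk
  obtain ⟨p, hp, q, hq, d, rfl⟩ := hk
  have hq' := eq_inv_of_mul_mem_units d hku
  have : p = g := by
    refine (hθ.isSlice a).2 hp ha' ?_
    rw [e, ArrowGroupoid.rng_mul c, ArrowGroupoid.rng_mul d]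
  rwa [hq', this] at hq

theorem star_elemsAt (hθ : T.IsEtaleRep θ) (g : G) :
    T.star (elemsAt θ g) = elemsAt θ (inv g) := by
  ext s
  constructor
  · rintro ⟨a, ha, b, h⟩
    exact hθ.inv_mem_of_domVia h ha
  · intro hs
    obtain ⟨t, ⟨b, k⟩, ht⟩ := hθ.locally_round _ _ hs
    have hb := hθ.inv_mem_of_domVia k ht
    rw [ArrowGroupoid.inv_inv] at hb
    -- From `t` dominated by `s` via `b` follows `btb` dominated by `b` via `s`, and `btb` is
    -- defined at `gg⁻¹g = g`.
    refine ⟨b * t * b, ?_, b, switch_left k.sa_mem k⟩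
    have h1 : ArrowGroupoid.mul g (inv g) ∈ θ (b * t) := hθ.mul_mem hb ht (comp_inv_right g)
    have h2 := hθ.mul_mem h1 hb (src_rng g)
    rwa [show ArrowGroupoid.mul (ArrowGroupoid.mul g (inv g)) g = g from rng_mul_self g] at h2

theorem isCoset_elemsAt (hθ : T.IsEtaleRep θ) (g : G) : T.IsCoset (elemsAt θ g) := by
  constructor
  · rw [hθ.star_elemsAt]
    rintro _ ⟨_, ⟨a, ha, s, hs, rfl⟩, b, hb, rfl⟩
    have h1 : ArrowGroupoid.mul g (inv g) ∈ θ (a * s) := hθ.mul_mem ha hs (comp_inv_right g)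
    have h2 := hθ.mul_mem h1 hb (src_rng g)
    rwa [show ArrowGroupoid.mul (ArrowGroupoid.mul g (inv g)) g = g from rng_mul_self g] at h2
  · apply Set.Subset.antisymm
    · intro a ha
      obtain ⟨b, h, hb⟩ := hθ.locally_round g a ha
      exact ⟨b, hb, h⟩
    · rintro b ⟨a, ha, h⟩
      exact hθ.mem_of_dom h ha

/-- The coset of all elements of `S` whose image contains `g`. -/
def coset (hθ : T.IsEtaleRep θ) (g : G) : T.Coset :=
  ⟨elemsAt θ g, hθ.isCoset_elemsAt g, hθ.cover g⟩

theorem mem_coset (hθ : T.IsEtaleRep θ) {g : G} {a : S} :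
    a ∈ (hθ.coset g).carrier ↔ g ∈ θ a := Iff.rfl

theorem coset_inv (hθ : T.IsEtaleRep θ) (g : G) : hθ.coset (inv g) = inv (hθ.coset g) :=
  Coset.ext (hθ.star_elemsAt g).symm

theorem up_coset_mul (hθ : T.IsEtaleRep θ) {g h : G} (k : Comp g h) :
    T.up ((hθ.coset g).carrier * (hθ.coset h).carrier) =
      (hθ.coset (ArrowGroupoid.mul g h)).carrier := by
  apply Set.Subset.antisymm
  · rintro c ⟨_, ⟨a, ha, b, hb, rfl⟩, l⟩
    exact hθ.mem_of_dom l (hθ.mul_mem ha hb k)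
  · intro a ha
    obtain ⟨a1, h1, l⟩ := (hθ.coset _).round ha
    obtain ⟨b, hb⟩ := (hθ.coset g).nonempty
    obtain ⟨c, hc, t, ht, m⟩ := (hθ.coset g).isCoset.exists_dom hb
    have ht' : inv g ∈ θ t := hθ.inv_mem_of_domVia m hc
    -- Here `ta₁` is defined at `g⁻¹(gh) = h`, while `(bt)a₁` is below `a` because `bt ∈ Z`.
    refine ⟨b * (t * a1), Set.mul_mem_mul hb ?_, ?_⟩
    · have := hθ.mul_mem ht' h1 (by unfold Comp; rw [src_inv, ArrowGroupoid.rng_mul k])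
      rwa [ArrowGroupoid.inv_mul_mul g h k] at this
    · rw [← mul_assoc]; exact l.n_mul (T.Z_le_N m.bs_mem)

theorem src_coset (hθ : T.IsEtaleRep θ) (g : G) : src (hθ.coset g) = hθ.coset (src g) := by
  apply Coset.ext
  rw [Coset.src_carrier, ← Coset.inv_carrier]
  change T.up ((inv (hθ.coset g)).carrier * _) = _
  rw [← hθ.coset_inv, hθ.up_coset_mul (comp_inv_left g)]
  rfl

theorem rng_coset (hθ : T.IsEtaleRep θ) (g : G) : rng (hθ.coset g) = hθ.coset (rng g) := by
  rw [← src_inv, ← coset_inv, src_coset, src_inv]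

theorem comp_coset (hθ : T.IsEtaleRep θ) {g h : G} (k : Comp g h) :
    Comp (hθ.coset g) (hθ.coset h) := by
  unfold Comp at k ⊢
  rw [src_coset, rng_coset, k]

theorem coset_mul (hθ : T.IsEtaleRep θ) {g h : G} (k : Comp g h) :
    hθ.coset (ArrowGroupoid.mul g h) = ArrowGroupoid.mul (hθ.coset g) (hθ.coset h) := by
  apply Coset.ext
  rw [← hθ.up_coset_mul k]
  exact (Coset.mul_carrier (Coset.comp_iff.1 (hθ.comp_coset k))).symm

/-- The relation `{(C, g) : C = {a : g ∈ θ(a)}}`. -/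
def cosetRel (hθ : T.IsEtaleRep θ) : Set (T.Coset × G) := {p | p.1 = hθ.coset p.2}

theorem isZakrzewski_cosetRel (hθ : T.IsEtaleRep θ) : IsZakrzewski hθ.cosetRel where
  functorial := by
    constructor
    · rintro _ h (rfl : _ = hθ.coset h)
      exact (hθ.coset_inv h).symm
    · rintro _ h _ h' (rfl : _ = hθ.coset h) (rfl : _ = hθ.coset h') k
      exact ⟨hθ.comp_coset k, (hθ.coset_mul k).symm⟩
  star_bijective := by
    intro C h hu hC
    replace hC : rng C = hθ.coset h := hC
    obtain ⟨b, hb⟩ := C.nonempty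
    obtain ⟨a, ha, s, hs, k⟩ := C.isCoset.exists_dom hb
    -- The lift `i` is found inside `θ(a)` by factoring `h ∈ θ(a)θ(s)`. Its coset shares `a` and the
    -- range with `C`, hence equals `C` by rigidity; the slice `θ(a)` gives uniqueness.
    have h1 : h ∈ θ (a * s) := by
      rw [← hθ.mem_coset, ← hC]
      exact Coset.mul_star_mem_rng ha hs
    rw [hθ.map_mul] at h1
    obtain ⟨i, hi, j, hj, l, e⟩ := h1
    have hr : rng i = h := by
      rw [← rng_of_mem_units hu, e, ArrowGroupoid.rng_mul l]
    refine ⟨i, ⟨hr, ?_⟩, ?_⟩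
    · refine Coset.eq_of_rng_eq ha (hθ.mem_coset.2 hi) ?_
      rw [rng_coset, hr, hC]
    · rintro i' ⟨hr', hi'⟩
      replace hi' : C = hθ.coset i' := hi'
      refine (hθ.isSlice a).2 ?_ hi (hr'.trans hr.symm)
      rw [← hθ.mem_coset, ← hi']
      exact ha
  continuous := by
    intro O hO
    rw [isOpen_iff_forall_mem_open]
    rintro g ⟨_, hC, (rfl : _ = hθ.coset g)⟩
    obtain ⟨F, f1, f2, f3⟩ := Coset.isOpen_iff.1 hO _ hC
    refine ⟨⋂ a ∈ F, θ a, ?_, f1.isOpen_biInter fun a _ => hθ.isOpen a,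
      Set.mem_iInter₂.2 fun a ha => f2 ha⟩
    intro g' hg'
    exact ⟨_, f3 (hθ.coset g') fun a ha => Set.mem_iInter₂.1 hg' a ha, rfl⟩

theorem isFunction_cosetRel (hθ : T.IsEtaleRep θ) : BinRel.IsFunction hθ.cosetRel := by
  rintro _ _ h (rfl : _ = hθ.coset h) (rfl : _ = hθ.coset h)
  rfl

end IsEtaleRep

/-! ### The Pierce morphism induced by a bundle representation, and its uniqueness. -/

namespace IsBundleRep

variable {F G : Type*} [ArrowGroupoid F] [TopologicalSpace F] [ArrowGroupoid G]
  [TopologicalSpace G] {π : F → G} {θ : S → Set (F × G)}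

theorem mul_mem (hθ : T.IsBundleRep π θ) {a b : S} {e f : F} {g h : G} (ha : (e, g) ∈ θ a)
    (hb : (f, h) ∈ θ b) (k : Comp g h) :
    (ArrowGroupoid.mul e f, ArrowGroupoid.mul g h) ∈ θ (a * b) := by
  rw [hθ.map_mul]; exact ⟨e, g, f, h, ha, hb, k, rfl⟩

theorem comp_of_mem (hθ : T.IsBundleRep π θ) {a b : S} {e f : F} {g h : G} (ha : (e, g) ∈ θ a)
    (hb : (f, h) ∈ θ b) (k : Comp g h) : Comp e f := by
  apply hθ.bundle.isocofibration.comp_of_map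
  rw [(hθ.isSliceSection a).proj _ _ ha, (hθ.isSliceSection b).proj _ _ hb]
  exact k

theorem exists_of_mem (_ : T.IsBundleRep π θ) {a : S} {g : G} (h : g ∈ BinRel.dom (θ a)) :
    ∃ f, (f, g) ∈ θ a := by
  obtain ⟨f, -, hf⟩ := h
  exact ⟨f, hf⟩

theorem mem_coset_of_mem (hθ : T.IsBundleRep π θ) {a : S} {f : F} {g : G} (h : (f, g) ∈ θ a) :
    a ∈ (hθ.etaleRep.coset g).carrier := ⟨f, trivial, h⟩

/-- Equivalent elements of the coset at `g` have the same value at `g`. -/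
theorem mem_of_equivalent (hθ : T.IsBundleRep π θ) {a b : S} {f : F} {g : G}
    (ha : (f, g) ∈ θ a) (hb : b ∈ (hθ.etaleRep.coset g).carrier)
    (h : T.Equivalent (hθ.etaleRep.coset g).carrier a b) : (f, g) ∈ θ b := by
  obtain ⟨e, he⟩ := hθ.exists_of_mem hb
  -- The relation `au = bu` gives equal products of the two values at `g` with the value of `θ(u)`
  -- at `g⁻¹`, which can be cancelled.
  obtain ⟨u, ⟨d, hd, c, k⟩, l⟩ := Germ.Equivalent.exists_right (hθ.mem_coset_of_mem ha) hb h
  obtain ⟨p, hp⟩ := hθ.exists_of_mem (hθ.etaleRep.inv_mem_of_domVia k hd)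
  have h1 := hθ.mul_mem ha hp (comp_inv_right g)
  have h2 := hθ.mul_mem he hp (comp_inv_right g)
  rw [l] at h1
  have h3 := (hθ.isSliceSection _).isFunction _ _ _ h1 h2
  rwa [mul_right_cancel_of_comp (hθ.comp_of_mem ha hp (comp_inv_right g))
    (hθ.comp_of_mem he hp (comp_inv_right g)) h3]

/-- The relation from `G` to `𝒞(S)` underlying the Pierce morphism induced by `θ`. -/
def rel (hθ : T.IsBundleRep π θ) : Set (T.Coset × G) := hθ.etaleRep.cosetRel

theorem exists_value (hθ : T.IsBundleRep π θ) (p : Pullback T.cosetBundle hθ.rel) :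
    ∃ f, (f, p.1.2) ∈ θ p.1.1.rep := by
  obtain ⟨⟨x, g⟩, h⟩ := p
  replace h : x.coset = hθ.etaleRep.coset g := h
  apply hθ.exists_of_mem
  have := x.rep_mem
  rw [h] at this
  exact this

/-- The functor `([c, C], g) ↦ θ(c)(g)`. -/
noncomputable def lift (hθ : T.IsBundleRep π θ) (p : Pullback T.cosetBundle hθ.rel) : F :=
  (hθ.exists_value p).choose

/-- Frees `lift` from its chosen representative: any other representative is equivalent to it and so
takes the same value. -/
theorem lift_mem (hθ : T.IsBundleRep π θ) (p : Pullback T.cosetBundle hθ.rel) {c : S}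
    {C : T.Coset} (hc : c ∈ C.carrier) (h : p.1.1 = Germ.mk' c C hc) :
    (hθ.lift p, p.1.2) ∈ θ c := by
  have hm := (hθ.exists_value p).choose_spec
  change (hθ.lift p, p.1.2) ∈ _ at hm
  generalize hθ.lift p = f at hm ⊢
  obtain ⟨⟨x, g⟩, hx⟩ := p
  replace hx : x.coset = hθ.etaleRep.coset g := hx
  subst h
  obtain rfl : C = hθ.etaleRep.coset g := hx
  exact hθ.mem_of_equivalent hm hc (Germ.equivalent_rep hc)

theorem lift_eq (hθ : T.IsBundleRep π θ) (p : Pullback T.cosetBundle hθ.rel) {c : S}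
    {C : T.Coset} (hc : c ∈ C.carrier) (h : p.1.1 = Germ.mk' c C hc) {f : F}
    (hf : (f, p.1.2) ∈ θ c) : hθ.lift p = f :=
  (hθ.isSliceSection c).isFunction _ _ _ (hθ.lift_mem p hc h) hf

theorem exists_rep_pullback (hθ : T.IsBundleRep π θ) (p : Pullback T.cosetBundle hθ.rel) :
    ∃ c, ∃ hc : c ∈ (hθ.etaleRep.coset p.1.2).carrier, p.1.1 = Germ.mk' c _ hc := by
  obtain ⟨⟨x, g⟩, hx⟩ := p
  obtain ⟨c, C, hc, -, -, -, -, rfl⟩ := x.exists_mk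
  obtain rfl : C = hθ.etaleRep.coset g := hx
  exact ⟨c, hc, rfl⟩

/-- On the open set of pairs whose first entry is a germ of `c`, the map is the continuous section
`θ(c)` applied to the second entry. -/
theorem continuous_lift (hθ : T.IsBundleRep π θ) : Continuous hθ.lift := by
  rw [continuous_def]
  intro O hO
  rw [isOpen_iff_forall_mem_open]
  intro p hp
  obtain ⟨c, hc, h⟩ := hθ.exists_rep_pullback p
  refine ⟨Subtype.val ⁻¹' ({x | ∃ C, ∃ hs : c ∈ C.carrier, x = Germ.mk' c C hs} ×ˢ
    BinRel.preim (θ c) O), ?_, ?_, ⟨_, hc, h⟩, _, hp, hθ.lift_mem p hc h⟩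
  · rintro q ⟨⟨C, hC, e⟩, f, hf, hm⟩
    rw [Set.mem_preimage, hθ.lift_eq q hC e hm]
    exact hf
  · exact ((Germ.isOpen_setOf_mk c).prod
      ((hθ.isSliceSection c).isContinuous O hO)).preimage continuous_subtype_val

theorem isPierce_lift (hθ : T.IsBundleRep π θ) : IsPierce T.cosetBundle π hθ.rel hθ.lift where
  zakrzewski := hθ.etaleRep.isZakrzewski_cosetRel
  isFunction := hθ.etaleRep.isFunction_cosetRel
  continuous := hθ.continuous_lift
  map_mul := by
    intro p q t k ht
    obtain ⟨a, ha, ea⟩ := hθ.exists_rep_pullback p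
    obtain ⟨b, hb, eb⟩ := hθ.exists_rep_pullback q
    have h1 := hθ.lift_mem p ha ea
    have h2 := hθ.lift_mem q hb eb
    refine ⟨hθ.comp_of_mem h1 h2 k, ?_⟩
    have hc := hθ.etaleRep.comp_coset k
    have e1 := congrArg Prod.fst ht
    have e2 := congrArg Prod.snd ht
    dsimp only at e1 e2
    rw [ea, eb, Germ.mk_mul_mk_of_comp hc] at e1
    refine hθ.lift_eq t _ e1 ?_
    rw [e2]
    exact hθ.mul_mem h1 h2 k
  proj := by
    intro p
    obtain ⟨a, ha, ea⟩ := hθ.exists_rep_pullback p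
    exact (hθ.isSliceSection a).proj _ _ (hθ.lift_mem p ha ea)

theorem eq_fracAct_lift (hθ : T.IsBundleRep π θ) (a : S) :
    θ a = fracAct hθ.rel hθ.lift (T.tildeSection a) := by
  ext ⟨f, g⟩
  constructor
  · intro h
    have ha := hθ.mem_coset_of_mem h
    refine ⟨⟨(Germ.mk' a (hθ.etaleRep.coset g) ha, g), rfl⟩, Germ.mk_mem_tildeSection ha, ?_⟩
    rw [hθ.lift_eq _ ha rfl h]
  · rintro ⟨p, ⟨C, hC, e⟩, e'⟩
    rw [e']
    exact hθ.lift_mem p hC (Prod.mk.inj e).1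

/-- Comparing domains in `θ(a) = (τ/φ)(ã)`, an arrow `g` lies in `dom θ(a)` exactly when some coset
related to `g` contains `a`. As `φ` is a function, that coset is the coset at `g`; as the domains
cover `G`, `φ` is defined everywhere. -/
theorem rel_eq (hθ : T.IsBundleRep π θ) {φ : Set (T.Coset × G)} {τ : Pullback T.cosetBundle φ → F}
    (hφ : IsPierce T.cosetBundle π φ τ) (h : ∀ a, θ a = fracAct φ τ (T.tildeSection a)) :
    φ = hθ.rel := by
  have key : ∀ a g, g ∈ BinRel.dom (θ a) → ∃ C : T.Coset, a ∈ C.carrier ∧ (C, g) ∈ φ := by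
    rintro a g ⟨f, -, hf⟩
    rw [h] at hf
    obtain ⟨p, ⟨C, hC, e⟩, e'⟩ := hf
    have h1 := p.2
    rw [(Prod.mk.inj e).2, ← (Prod.mk.inj e').2] at h1
    exact ⟨C, hC, h1⟩
  have key' : ∀ C g, (C, g) ∈ φ → C = hθ.etaleRep.coset g := by
    intro C g hC
    apply Coset.ext
    apply Set.Subset.antisymm
    · intro a ha
      refine hθ.etaleRep.mem_coset.2 ⟨τ ⟨(Germ.mk' a C ha, g), hC⟩, trivial, ?_⟩
      rw [h]
      exact ⟨_, Germ.mk_mem_tildeSection ha, rfl⟩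
    · intro a ha
      obtain ⟨D, hD, hD'⟩ := key a g ha
      rwa [hφ.isFunction C D g hC hD']
  ext ⟨C, g⟩
  constructor
  · exact key' C g
  · rintro (hC : C = hθ.etaleRep.coset g)
    obtain ⟨a, ha⟩ := hθ.etaleRep.cover g
    obtain ⟨D, hD, hD'⟩ := key a g ha
    rwa [hC, ← key' D g hD']

end IsBundleRep

end StructuredSemigroup

theorem theorem10p2 {S : Type u} [Semigroup S] (T : StructuredSemigroup S)
    (hZ : T.IsSymmetric) :
    StructuredSemigroup.IsUniversalBundleRep.{u, v, w} T T.cosetBundle T.tildeSection := by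
  refine ⟨StructuredSemigroup.isBundleRep_tildeSection hZ, ?_⟩
  intro F' G' _ _ _ _ π' θ hθ
  refine ⟨⟨hθ.rel, hθ.lift⟩, ⟨hθ.isPierce_lift, hθ.eq_fracAct_lift⟩, ?_⟩
  rintro ⟨φ, τ⟩ ⟨hφ, h⟩
  dsimp only at hφ h
  obtain rfl := hθ.rel_eq hφ h
  congr 1
  funext p
  obtain ⟨a, ha, e⟩ := hθ.exists_rep_pullback p
  -- A point of the pullback is `([a, C], g)`, where `τ` takes the value of `(τ/φ)(ã) = θ(a)` at
  -- `g`; this leaves no choice for `τ`.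
  refine (hθ.lift_eq p ha e ?_).symm
  rw [h]
  refine ⟨p, ?_, rfl⟩
  change (p.1.1, p.1.1.coset) ∈ _
  rw [e]
  exact StructuredSemigroup.Germ.mk_mem_tildeSection ha
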